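/- Consider the class of equations $$u_t+uu_x+h(t)u_{xxt}=l(t)\qquad(*)$$ for $u=u(t,x)$, where the arbitrary elements $h,l$ are smooth real functions on a nonempty open interval $I$ and $h$ vanishes nowhere on $I$. A point transformation is a smooth map $\Phi\colon(t,x,u)\mapsto(\tilde t,\tilde x,\tilde u)$ with nonvanishing Jacobian on a nonempty connected open subset $\Omega$ of $\mathbb R^3$; it maps one equation of the class to another one if, over $\Omega$, wherever its prolongation is defined, a third-order jet lies on the manifold given by the first equation in the third-order jet space if and only if the prolonged image of the jet lies on the manifold given by the second equation. An equivalence transformation (in the usual sense) is a nondegenerate smooth transformation $(t,x,u,h,l)\mapsto(\tilde t,\tilde x,\tilde u,\tilde h,\tilde l)$, defined for $(t,x,u)\in\Omega$, $h\ne0$, $l\in\mathbb R$, whose components $\tilde t,\tilde x,\tilde u$ depend only on $(t,x,u)$ and form a point transformation, and which for every equation of the class maps that equation (over the part of $\Omega$ with $t\in I$) to an equation of the class whose arbitrary elements are the transformed ones. Theorem. The usual equivalence group $G^\sim_3$ of the class $(*)$ consists exactly of the transformations $$\tilde t=\frac{\delta_1}{\delta_3}t+\delta_0,\quad \tilde x=\delta_1x+\delta_2,\quad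 \tilde u=\delta_3u,\quad \tilde h=\delta_1^2h,\quad \tilde l=\frac{\delta_3^2}{\delta_1}l,$$ where $\delta_0,\delta_1,\delta_2,\delta_3$ are arbitrary real constants with $\delta_1\delta_3\neq0$ (on any domain $\Omega$, each usual equivalence transformation is the restriction of one of these, and each such restriction is one). Moreover, the class $(*)$ is normalized in the usual sense: whenever a point transformation $\Phi$ on $\Omega$ maps an equation of the class with arbitrary elements $(h,l)$ to an equation of the class with arbitrary elements $(\tilde h,\tilde l)$, there is an element of $G^\sim_3$, defined for all $(t,x,u)\in\mathbb R^3$, whose $(t,x,u)$-part coincides with $\Phi$ on $\Omega$ and which sends $(h,l)$ to $(\tilde h,\tilde l)$ over $\Omega$. -/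

import Mathlib

open Set Filter Topology
open scoped ContDiff

namespace BBM

/-- The space of the independent and dependent variables `(t, x, u)`. -/
abbrev Space := ℝ × ℝ × ℝ

/-- Partial derivative `∂/∂t` of a function of `(t, x)`. -/
noncomputable def Dt (u : ℝ × ℝ → ℝ) : ℝ × ℝ → ℝ := fun z => fderiv ℝ u z (1, 0)

/-- Partial derivative `∂/∂x` of a function of `(t, x)`. -/
noncomputable def Dx (u : ℝ × ℝ → ℝ) : ℝ × ℝ → ℝ := fun z => fderiv ℝ u z (0, 1)

/-- An equation `u_t + u u_x + h(t) u_{xxt} = l(t)` of the class: the arbitrary elements `h`, `l`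
are smooth functions on a nonempty open interval `I`, and `h` does not vanish there.
(Values of `h`, `l` outside `I` are never used.) -/
structure Equation where
  I : Set ℝ
  isOpen_I : IsOpen I
  ordConnected_I : I.OrdConnected
  nonempty_I : I.Nonempty
  h : ℝ → ℝ
  l : ℝ → ℝ
  smooth_h : ContDiffOn ℝ ∞ h I
  smooth_l : ContDiffOn ℝ ∞ l I
  h_ne_zero : ∀ t ∈ I, h t ≠ 0

/-- The equation holds for `u` at the single point `z = (t, x)`, that is, the third-order jet of `u`
at `z` lies on the manifold which the equation defines in the third-order jet space. -/
def Equation.HoldsAt (E : Equation) (u : ℝ × ℝ → ℝ) (z : ℝ × ℝ) : Prop :=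
  Dt u z + u z * Dx u z + E.h z.1 * Dt (Dx (Dx u)) z = E.l z.1

/-- A point transformation `(t, x, u) ↦ (T, X, U)`: a smooth map with nonvanishing Jacobian
on a (nonempty) connected open set `dom`. -/
structure PointTransformation where
  dom : Set Space
  isOpen_dom : IsOpen dom
  isConnected_dom : IsConnected dom
  toFun : Space → Space
  smooth : ContDiffOn ℝ ∞ toFun dom
  jacobian_ne_zero : ∀ p ∈ dom, (fderiv ℝ toFun p).det ≠ 0

/-- The point `(t, x, u(t, x))` of the graph of `u` over `z = (t, x)`. -/
def graphPt (u : ℝ × ℝ → ℝ) (z : ℝ × ℝ) : Space := (z.1, z.2, u z)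

/-- The independent variables `(T, X)` of the image under `Φ` of the point of the graph of `u`
over `z`. -/
def basePt (Φ : Space → Space) (u : ℝ × ℝ → ℝ) (z : ℝ × ℝ) : ℝ × ℝ :=
  ((Φ (graphPt u z)).1, (Φ (graphPt u z)).2.1)

/-- Near the point over `z`, the map `Φ` carries the graph of the smooth function `u` to the graph
of the smooth function `v`, transversally (the total Jacobian `D(T, X)/D(t, x)` does not vanish).
Then the jets of `v` at `basePt Φ u z` are the values of the prolongations of `Φ` at the jets
of `u` at `z`. -/
def CarriesGerm (Φ : Space → Space) (u : ℝ × ℝ → ℝ) (z : ℝ × ℝ) (v : ℝ × ℝ → ℝ) : Prop :=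
  ContDiffAt ℝ ∞ u z ∧
  ContDiffAt ℝ ∞ v (basePt Φ u z) ∧
  (fderiv ℝ (basePt Φ u) z).det ≠ 0 ∧
  ∀ᶠ z' in 𝓝 z, v (basePt Φ u z') = (Φ (graphPt u z')).2.2

/-- Over the set `S` of the space of `(t, x, u)`, the map `Φ` transforms the equation `E` to the
equation `E'`: a third-order jet over `S` lies on the manifold of `E` if and only if its image
under the prolongation of `Φ` lies on the manifold of `E'`. -/
def MapsOn (Φ : Space → Space) (S : Set Space) (E E' : Equation) : Prop :=
  (∀ p ∈ S, p.1 ∈ E.I ∧ (Φ p).1 ∈ E'.I) ∧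
  ∀ (u v : ℝ × ℝ → ℝ) (z : ℝ × ℝ), graphPt u z ∈ S → CarriesGerm Φ u z v →
    (E.HoldsAt u z ↔ E'.HoldsAt v (basePt Φ u z))

/-- An admissible transformation of the class: a triple of two equations of the class and a point
transformation that maps the first to the second. -/
structure AdmissibleTransformation where
  source : Equation
  target : Equation
  map : PointTransformation
  maps : MapsOn map.toFun map.dom source target

/-- A joint transformation of the variables `(t, x, u)` and the arbitrary elements `(h, l)`,
whose components for `(t, x, u)` do not depend on the arbitrary elements (the usual kind):
`((t, x, u), (h, l)) ↦ (pt (t, x, u), elems ((t, x, u), (h, l)))`, where `h ≠ 0`,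
smooth and with nonvanishing Jacobian. -/
structure JointTransformation where
  pt : PointTransformation
  elems : Space × (ℝ × ℝ) → ℝ × ℝ
  smooth : ContDiffOn ℝ ∞ elems {q | q.1 ∈ pt.dom ∧ q.2.1 ≠ 0}
  jacobian_ne_zero : ∀ q : Space × (ℝ × ℝ), q.1 ∈ pt.dom → q.2.1 ≠ 0 →
    (fderiv ℝ (fun q' : Space × (ℝ × ℝ) => (pt.toFun q'.1, elems q')) q).det ≠ 0

/-- Over `S`, the arbitrary elements of `E'` are those which the joint transformation `A` assigns
to the arbitrary elements of `E`. -/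
def JointTransformation.SendsElems (A : JointTransformation) (S : Set Space)
    (E E' : Equation) : Prop :=
  ∀ p ∈ S, A.elems (p, (E.h p.1, E.l p.1)) =
    (E'.h (A.pt.toFun p).1, E'.l (A.pt.toFun p).1)

/-- Membership in the usual equivalence group: every equation `E` of the class is mapped by the
point transformation to an equation `E'` of the class, with the arbitrary elements transformed
as prescribed. -/
def JointTransformation.IsUsualEquivalence (A : JointTransformation) : Prop :=
  ∀ E : Equation, ∃ E' : Equation,
    MapsOn A.pt.toFun {p ∈ A.pt.dom | p.1 ∈ E.I} E E' ∧
    A.SendsElems {p ∈ A.pt.dom | p.1 ∈ E.I} E E'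

/-- The class is normalized in the usual sense: every admissible transformation is induced by an
(everywhere defined) element of the usual equivalence group. -/
def NormalizedUsual : Prop :=
  ∀ a : AdmissibleTransformation, ∃ A : JointTransformation,
    A.IsUsualEquivalence ∧ A.pt.dom = univ ∧
    EqOn a.map.toFun A.pt.toFun a.map.dom ∧
    A.SendsElems a.map.dom a.source a.target

end BBM

/-! A point transformation acts on third-order jets, and cubic leading terms are transported by the
total Jacobian matrix of (T, X). Among the third-order derivatives only u_txx occurs in the
equation, so the other three are free on its manifold. Hence a cubic form without a t x² term may be
added to a jet on the manifold, and its transport must have no T X² term (`cubic_coeff_eq_zero`).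
Applied to the forms transported from t³, x³ and t²x, this gives D_x T = D_t X = 0 wherever the
total Jacobian is nonzero (`totalDeriv_eq_zero`). Since u_t and u_x are arbitrary up to that
restriction, T_x = T_u = X_t = X_u = 0 (`partial_eq_zero`).

For such maps the prolongation is explicit (`Separated.jet`). Eliminating u_txx by the source
equation and splitting the target equation in the remaining derivatives yields the determining
equations (`Separated.determining_equations`). With h', l' the target elements, the coefficient of
u_x reads U T_t X_x h = h' u, so U = U_u u; with U_tu = 0 also U_t = 0. In the part free of
derivatives only one term then depends on u, a multiple of U_xu u², whence U_xu = 0 and X_xx = 0.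
What remains expresses T_t, h', l' through X_x and U_u, which are constant because the domain is
connected (`exists_parameters`).

This already gives the form of a single admissible transformation, so normalization follows once
scalings and translations are known to preserve the class (`mapsOn_scale`). The equivalence group is
found by testing a joint transformation on equations with constant arbitrary elements. -/

namespace BBM

open Asymptotics

/-! ### Derivatives and third-order contact in the (t, x)-plane -/

section PlaneCalculus

variable {W : Set (ℝ × ℝ)} {f g : ℝ × ℝ → ℝ} {z : ℝ × ℝ} {m n : WithTop ℕ∞}

theorem contDiffOn_Dt (hf : ContDiffOn ℝ n f W) (hW : IsOpen W) (h : m + 1 ≤ n) :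
    ContDiffOn ℝ m (Dt f) W :=
  (hf.fderiv_of_isOpen hW h).clm_apply contDiffOn_const

theorem contDiffOn_Dx (hf : ContDiffOn ℝ n f W) (hW : IsOpen W) (h : m + 1 ≤ n) :
    ContDiffOn ℝ m (Dx f) W :=
  (hf.fderiv_of_isOpen hW h).clm_apply contDiffOn_const

theorem eqOn_Dt (hW : IsOpen W) (h : EqOn f g W) : EqOn (Dt f) (Dt g) W := fun z hz => by
  have : f =ᶠ[𝓝 z] g := h.eventuallyEq_of_mem (hW.mem_nhds hz)
  simp only [Dt, this.fderiv_eq]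

theorem eqOn_Dx (hW : IsOpen W) (h : EqOn f g W) : EqOn (Dx f) (Dx g) W := fun z hz => by
  have : f =ᶠ[𝓝 z] g := h.eventuallyEq_of_mem (hW.mem_nhds hz)
  simp only [Dx, this.fderiv_eq]

theorem Dt_eq_of_hasFDerivAt {f' : ℝ × ℝ →L[ℝ] ℝ} (h : HasFDerivAt f f' z) :
    Dt f z = f' (1, 0) := by simp only [Dt, h.fderiv]

theorem Dx_eq_of_hasFDerivAt {f' : ℝ × ℝ →L[ℝ] ℝ} (h : HasFDerivAt f f' z) :
    Dx f z = f' (0, 1) := by simp only [Dx, h.fderiv]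

theorem Dt_add (hf : DifferentiableAt ℝ f z) (hg : DifferentiableAt ℝ g z) :
    Dt (fun z => f z + g z) z = Dt f z + Dt g z :=
  Dt_eq_of_hasFDerivAt (hf.hasFDerivAt.add hg.hasFDerivAt)

theorem Dx_add (hf : DifferentiableAt ℝ f z) (hg : DifferentiableAt ℝ g z) :
    Dx (fun z => f z + g z) z = Dx f z + Dx g z :=
  Dx_eq_of_hasFDerivAt (hf.hasFDerivAt.add hg.hasFDerivAt)

theorem Dt_mul (hf : DifferentiableAt ℝ f z) (hg : DifferentiableAt ℝ g z) :
    Dt (fun z => f z * g z) z = Dt f z * g z + f z * Dt g z := by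
  refine (Dt_eq_of_hasFDerivAt (hf.hasFDerivAt.mul hg.hasFDerivAt)).trans ?_
  simp [Dt]; ring

theorem Dx_mul (hf : DifferentiableAt ℝ f z) (hg : DifferentiableAt ℝ g z) :
    Dx (fun z => f z * g z) z = Dx f z * g z + f z * Dx g z := by
  refine (Dx_eq_of_hasFDerivAt (hf.hasFDerivAt.mul hg.hasFDerivAt)).trans ?_
  simp [Dx]; ring

theorem Dt_const_mul (c : ℝ) (hf : DifferentiableAt ℝ f z) :
    Dt (fun z => c * f z) z = c * Dt f z := by
  rw [Dt_eq_of_hasFDerivAt (hf.hasFDerivAt.const_mul c)]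
  simp [Dt]

theorem Dx_const_mul (c : ℝ) (hf : DifferentiableAt ℝ f z) :
    Dx (fun z => c * f z) z = c * Dx f z := by
  rw [Dx_eq_of_hasFDerivAt (hf.hasFDerivAt.const_mul c)]
  simp [Dx]

theorem hasDerivAt_snd (hf : DifferentiableAt ℝ f z) :
    HasDerivAt (fun x => f (z.1, x)) (Dx f z) z.2 := by
  have h1 : HasDerivAt (fun x : ℝ => (z.1, x)) ((0 : ℝ), (1 : ℝ)) z.2 :=
    (hasDerivAt_const _ _).prodMk (hasDerivAt_id _)
  exact hf.hasFDerivAt.comp_hasDerivAt z.2 h1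

theorem hasDerivAt_fst (hf : DifferentiableAt ℝ f z) :
    HasDerivAt (fun t => f (t, z.2)) (Dt f z) z.1 := by
  have h1 : HasDerivAt (fun t : ℝ => (t, z.2)) ((1 : ℝ), (0 : ℝ)) z.1 :=
    (hasDerivAt_id _).prodMk (hasDerivAt_const _ _)
  exact hf.hasFDerivAt.comp_hasDerivAt z.1 h1

/-- A mixed third-order finite difference equals the mixed third derivative at some point. -/
theorem exists_Dt_Dx_Dx_eq {s : ℝ} (hs : 0 < s) (hW : IsOpen W)
    (hsub : Icc z.1 (z.1 + s) ×ˢ Icc z.2 (z.2 + 2 * s) ⊆ W) (hf : ContDiffOn ℝ 3 f W) :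
    ∃ y ∈ Icc z.1 (z.1 + s) ×ˢ Icc z.2 (z.2 + 2 * s),
      s ^ 3 * Dt (Dx (Dx f)) y =
        (f (z.1 + s, z.2 + 2 * s) - 2 * f (z.1 + s, z.2 + s) + f (z.1 + s, z.2)) -
        (f (z.1, z.2 + 2 * s) - 2 * f (z.1, z.2 + s) + f (z.1, z.2)) := by
  have dif : ∀ {F : ℝ × ℝ → ℝ}, ContDiffOn ℝ 1 F W → ∀ y ∈ W, DifferentiableAt ℝ F y :=
    fun hF y hy => (hF.contDiffAt (hW.mem_nhds hy)).differentiableAt (by norm_num)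
  have d0 := dif (hf.of_le (by norm_num))
  have c1 : ContDiffOn ℝ 2 (Dx f) W := contDiffOn_Dx hf hW (by norm_num)
  have d1 := dif (c1.of_le (by norm_num))
  have d2 := dif (contDiffOn_Dx (m := 1) c1 hW (by norm_num))
  have mem : ∀ a b, a ∈ Icc z.1 (z.1 + s) → b ∈ Icc z.2 (z.2 + 2 * s) → (a, b) ∈ W :=
    fun a b ha hb => hsub ⟨ha, hb⟩
  have l0 : z.1 ∈ Icc z.1 (z.1 + s) := ⟨le_rfl, by linarith⟩
  have l1 : z.1 + s ∈ Icc z.1 (z.1 + s) := ⟨by linarith, le_rfl⟩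
  -- The mixed difference is `k (z.2 + s) - k z.2`. The mean value theorem, twice in x and once in
  -- t, extracts one factor s each time.
  let k : ℝ → ℝ := fun x =>
    (f (z.1 + s, x + s) - f (z.1, x + s)) - (f (z.1 + s, x) - f (z.1, x))
  have hk : ∀ x ∈ Icc z.2 (z.2 + s), HasDerivAt k
      ((Dx f (z.1 + s, x + s) - Dx f (z.1, x + s)) - (Dx f (z.1 + s, x) - Dx f (z.1, x))) x := by
    intro x hx
    have hx1 : x + s ∈ Icc z.2 (z.2 + 2 * s) := ⟨by linarith [hx.1], by linarith [hx.2]⟩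
    have hx0 : x ∈ Icc z.2 (z.2 + 2 * s) := ⟨hx.1, by linarith [hx.2]⟩
    exact (((hasDerivAt_snd (d0 _ (mem _ _ l1 hx1))).comp_add_const x s).sub
      ((hasDerivAt_snd (d0 _ (mem _ _ l0 hx1))).comp_add_const x s)).sub
      ((hasDerivAt_snd (d0 _ (mem _ _ l1 hx0))).sub (hasDerivAt_snd (d0 _ (mem _ _ l0 hx0))))
  obtain ⟨x₁, hx₁, e₁⟩ := exists_hasDerivAt_eq_slope k _ (show z.2 < z.2 + s by linarith)
    (fun x hx => (hk x hx).continuousAt.continuousWithinAt)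
    (fun x hx => hk x (Ioo_subset_Icc_self hx))
  have hk' : ∀ x ∈ Icc x₁ (x₁ + s), HasDerivAt (fun x => Dx f (z.1 + s, x) - Dx f (z.1, x))
      (Dx (Dx f) (z.1 + s, x) - Dx (Dx f) (z.1, x)) x := by
    intro x hx
    have hx0 : x ∈ Icc z.2 (z.2 + 2 * s) :=
      ⟨by linarith [hx.1, hx₁.1], by linarith [hx.2, hx₁.2]⟩
    exact (hasDerivAt_snd (d1 _ (mem _ _ l1 hx0))).sub (hasDerivAt_snd (d1 _ (mem _ _ l0 hx0)))
  obtain ⟨x₂, hx₂, e₂⟩ := exists_hasDerivAt_eq_slope _ _ (show x₁ < x₁ + s by linarith)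
    (fun x hx => (hk' x hx).continuousAt.continuousWithinAt)
    (fun x hx => hk' x (Ioo_subset_Icc_self hx))
  have hx0 : x₂ ∈ Icc z.2 (z.2 + 2 * s) :=
    ⟨by linarith [hx₂.1, hx₁.1], by linarith [hx₂.2, hx₁.2]⟩
  have hk'' : ∀ t ∈ Icc z.1 (z.1 + s), HasDerivAt (fun t => Dx (Dx f) (t, x₂))
      (Dt (Dx (Dx f)) (t, x₂)) t := fun t ht => hasDerivAt_fst (d2 _ (mem _ _ ht hx0))
  obtain ⟨t, ht, e₃⟩ := exists_hasDerivAt_eq_slope _ _ (show z.1 < z.1 + s by linarith)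
    (fun x hx => (hk'' x hx).continuousAt.continuousWithinAt)
    (fun x hx => hk'' x (Ioo_subset_Icc_self hx))
  refine ⟨(t, x₂), ⟨Ioo_subset_Icc_self ht, hx0⟩, ?_⟩
  rw [add_sub_cancel_left, eq_div_iff hs.ne'] at e₁ e₂ e₃
  have e₄ : k (z.2 + s) - k z.2 =
      (f (z.1 + s, z.2 + 2 * s) - 2 * f (z.1 + s, z.2 + s) + f (z.1 + s, z.2)) -
        (f (z.1, z.2 + 2 * s) - 2 * f (z.1, z.2 + s) + f (z.1, z.2)) := by
    simp only [k, show z.2 + s + s = z.2 + 2 * s by ring]; ring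
  rw [← e₄]
  linear_combination s ^ 2 * e₃ + s * e₂ + e₁

/-- A mixed difference of step s is o(s³), yet it equals s³ times the mixed derivative at a point
tending to `z`; continuity of that derivative concludes. -/
theorem Dt_Dx_Dx_eq_zero_of_isLittleO (hf : ContDiffAt ℝ 3 f z)
    (ho : f =o[𝓝 z] fun y => ‖y - z‖ ^ 3) : Dt (Dx (Dx f)) z = 0 := by
  obtain ⟨W, hWs, hW, hzW⟩ := mem_nhds_iff.1 (hf.eventually (by decide))
  have hfW : ContDiffOn ℝ 3 f W := fun y hy =>
    ContDiffAt.contDiffWithinAt (hWs hy)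
  have hcont : ContinuousAt (Dt (Dx (Dx f))) z :=
    (((contDiffOn_Dt (m := 0) (contDiffOn_Dx (m := 1) (contDiffOn_Dx (m := 2) hfW hW
      (by norm_num)) hW (by norm_num)) hW (by norm_num)).continuousOn).continuousAt
      (hW.mem_nhds hzW))
  -- The six values in the mixed difference have weights of total size 8 and are each at most ε
  -- (2s)³, which gives 64 ε. Passing from `y` to `z` costs one more ε.
  have key : ∀ ε > 0, |Dt (Dx (Dx f)) z| ≤ 65 * ε := by
    intro ε hε
    have h1 := hcont (Metric.ball_mem_nhds _ hε)
    have h2 := ho.bound hε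
    obtain ⟨r, hr, hball⟩ := Metric.mem_nhds_iff.1
      (inter_mem (inter_mem h1 h2) (hW.mem_nhds hzW))
    have hs : 0 < r / 3 := by linarith
    set s := r / 3 with hsdef
    have hbox : Icc z.1 (z.1 + s) ×ˢ Icc z.2 (z.2 + 2 * s) ⊆
        {y | y ∈ Metric.ball z r ∧ ‖y - z‖ ≤ 2 * s} := by
      rintro ⟨a, b⟩ ⟨ha, hb⟩
      have : ‖(a, b) - z‖ ≤ 2 * s := by
        rw [Prod.norm_def]
        simp only [Prod.fst_sub, Prod.snd_sub, Real.norm_eq_abs] at *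
        refine max_le ?_ ?_ <;> rw [abs_le] <;> constructor <;>
          linarith [ha.1, ha.2, hb.1, hb.2]
      refine ⟨?_, this⟩
      rw [Metric.mem_ball, dist_eq_norm]
      linarith
    obtain ⟨y, hy, e⟩ := exists_Dt_Dx_Dx_eq hs hW
      (fun y hy => (hball (hbox hy).1).2) hfW
    have bd : ∀ y ∈ Icc z.1 (z.1 + s) ×ˢ Icc z.2 (z.2 + 2 * s), |f y| ≤ ε * (2 * s) ^ 3 := by
      intro y hy
      have h3 : ‖f y‖ ≤ ε * ‖‖y - z‖ ^ 3‖ := (hball (hbox hy).1).1.2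
      rw [Real.norm_eq_abs, Real.norm_of_nonneg (by positivity)] at h3
      refine h3.trans ?_
      have := (hbox hy).2
      gcongr
    have l0 : z.1 ∈ Icc z.1 (z.1 + s) := ⟨le_rfl, by linarith⟩
    have l1 : z.1 + s ∈ Icc z.1 (z.1 + s) := ⟨by linarith, le_rfl⟩
    have m0 : z.2 ∈ Icc z.2 (z.2 + 2 * s) := ⟨le_rfl, by linarith⟩
    have m1 : z.2 + s ∈ Icc z.2 (z.2 + 2 * s) := ⟨by linarith, by linarith⟩
    have m2 : z.2 + 2 * s ∈ Icc z.2 (z.2 + 2 * s) := ⟨by linarith, le_rfl⟩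
    have b1 := abs_le.1 (bd (z.1 + s, z.2 + 2 * s) ⟨l1, m2⟩)
    have b2 := abs_le.1 (bd (z.1 + s, z.2 + s) ⟨l1, m1⟩)
    have b3 := abs_le.1 (bd (z.1 + s, z.2) ⟨l1, m0⟩)
    have b4 := abs_le.1 (bd (z.1, z.2 + 2 * s) ⟨l0, m2⟩)
    have b5 := abs_le.1 (bd (z.1, z.2 + s) ⟨l0, m1⟩)
    have b6 := abs_le.1 (bd (z.1, z.2) ⟨l0, m0⟩)
    have hs3 : 0 < s ^ 3 := by positivity
    have e' : |Dt (Dx (Dx f)) y| ≤ 64 * ε := by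
      rw [abs_le]
      constructor
      · refine le_of_mul_le_mul_left ?_ hs3
        rw [e]
        simp only [Prod.mk.eta] at *
        linarith [b1.1, b2.2, b3.1, b4.2, b5.1, b6.2]
      · refine le_of_mul_le_mul_left ?_ hs3
        rw [e]
        simp only [Prod.mk.eta] at *
        linarith [b1.2, b2.1, b3.2, b4.1, b5.2, b6.1]
    have h4 : dist (Dt (Dx (Dx f)) y) (Dt (Dx (Dx f)) z) < ε := (hball (hbox hy).1).1.1
    rw [Real.dist_eq, abs_sub_lt_iff] at h4
    rw [abs_le] at e' ⊢
    constructor <;> linarith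
  have : |Dt (Dx (Dx f)) z| ≤ 0 := le_of_forall_pos_le_add fun ε hε => by
    have := key (ε / 65) (by positivity)
    linarith
  exact abs_nonpos_iff.1 this

/-- The third-order Taylor data entering the equations do not change under a perturbation
of order `o(‖y - z‖ ^ 3)`. -/
theorem jet_eq_of_isLittleO (hf : ContDiffAt ℝ 3 f z) (hg : ContDiffAt ℝ 3 g z)
    (ho : (fun y => f y - g y) =o[𝓝 z] fun y => ‖y - z‖ ^ 3) :
    f z = g z ∧ Dt f z = Dt g z ∧ Dx f z = Dx g z ∧
      Dt (Dx (Dx f)) z = Dt (Dx (Dx g)) z := by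
  have hd : ContDiffAt ℝ 3 (fun y => f y - g y) z := hf.sub hg
  have h0 : f z - g z = 0 := by
    have := ho.bound one_pos
    simpa using this.self_of_nhds
  have hfd : HasFDerivAt (fun y => f y - g y) (0 : ℝ × ℝ →L[ℝ] ℝ) z := by
    rw [hasFDerivAt_iff_isLittleO]
    simp only [h0, sub_zero, zero_apply]
    refine ho.trans_isBigO ?_
    have : (fun y => ‖y - z‖ ^ 3) =O[𝓝 z] fun y => ‖y - z‖ * 1 := by
      have h2 : (fun y => ‖y - z‖ ^ 2) =O[𝓝 z] fun _ => (1 : ℝ) := by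
        have : ContinuousAt (fun y => ‖y - z‖ ^ 2) z := by fun_prop
        exact this.isBigO_one ℝ
      refine ((isBigO_refl (fun y => ‖y - z‖) (𝓝 z)).mul h2).congr_left fun y => by ring
    simpa using this
  have hgd := hg.differentiableAt (by norm_num)
  have e1 : fderiv ℝ f z = fderiv ℝ g z := by
    have := (hfd.add hgd.hasFDerivAt).fderiv
    rw [zero_add] at this
    rw [← this]
    congr 1; ext y; simp
  obtain ⟨W, hWs, hW, hzW⟩ := mem_nhds_iff.1 ((hd.eventually (by decide)).and
    (hg.eventually (by decide)))
  have hdW : ContDiffOn ℝ 3 (fun y => f y - g y) W := fun y hy => (hWs hy).1.contDiffWithinAt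
  have hgW : ContDiffOn ℝ 3 g W := fun y hy => (hWs hy).2.contDiffWithinAt
  have dif : ∀ {F : ℝ × ℝ → ℝ}, ContDiffOn ℝ 1 F W → ∀ y ∈ W, DifferentiableAt ℝ F y :=
    fun hF y hy => (hF.contDiffAt (hW.mem_nhds hy)).differentiableAt (by norm_num)
  have a0 : EqOn f (fun y => (f y - g y) + g y) W := fun y _ => by ring
  have hd1 : ContDiffOn ℝ 2 (Dx fun y => f y - g y) W := contDiffOn_Dx hdW hW (by norm_num)
  have hg1 : ContDiffOn ℝ 2 (Dx g) W := contDiffOn_Dx hgW hW (by norm_num)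
  have hd2 : ContDiffOn ℝ 1 (Dx (Dx fun y => f y - g y)) W := contDiffOn_Dx hd1 hW (by norm_num)
  have hg2 : ContDiffOn ℝ 1 (Dx (Dx g)) W := contDiffOn_Dx hg1 hW (by norm_num)
  have a1 : EqOn (Dx f) (fun y => Dx (fun y => f y - g y) y + Dx g y) W := fun y hy => by
    rw [eqOn_Dx hW a0 hy]
    exact Dx_add (dif (hdW.of_le (by norm_num)) y hy) (dif (hgW.of_le (by norm_num)) y hy)
  have a2 : EqOn (Dx (Dx f)) (fun y => Dx (Dx fun y => f y - g y) y + Dx (Dx g) y) W :=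
    fun y hy => by
      rw [eqOn_Dx hW a1 hy]
      exact Dx_add (dif (hd1.of_le (by norm_num)) y hy) (dif (hg1.of_le (by norm_num)) y hy)
  have a3 : Dt (Dx (Dx f)) z = Dt (Dx (Dx fun y => f y - g y)) z + Dt (Dx (Dx g)) z := by
    rw [eqOn_Dt hW a2 hzW]
    exact Dt_add (dif hd2 z hzW) (dif hg2 z hzW)
  rw [Dt_Dx_Dx_eq_zero_of_isLittleO hd ho, zero_add] at a3
  exact ⟨sub_eq_zero.1 h0, by simp only [Dt, e1], by simp only [Dx, e1], a3⟩

end PlaneCalculus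

/-! ### Cubic polynomials as representatives of jets -/

/-- The polynomial with prescribed derivatives at `z₀`, of degree at most three. -/
noncomputable def cubic (z₀ : ℝ × ℝ) (a₀₀ a₁₀ a₀₁ a₂₀ a₁₁ a₀₂ a₃₀ a₂₁ a₁₂ a₀₃ : ℝ) (z : ℝ × ℝ) : ℝ :=
  a₀₀ + a₁₀ * (z.1 - z₀.1) + a₀₁ * (z.2 - z₀.2) + a₂₀ / 2 * (z.1 - z₀.1) ^ 2 +
    a₁₁ * (z.1 - z₀.1) * (z.2 - z₀.2) + a₀₂ / 2 * (z.2 - z₀.2) ^ 2 +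
    a₃₀ / 6 * (z.1 - z₀.1) ^ 3 + a₂₁ / 2 * (z.1 - z₀.1) ^ 2 * (z.2 - z₀.2) +
    a₁₂ / 2 * (z.1 - z₀.1) * (z.2 - z₀.2) ^ 2 + a₀₃ / 6 * (z.2 - z₀.2) ^ 3

section Cubic

variable (z₀ : ℝ × ℝ) (a₀₀ a₁₀ a₀₁ a₂₀ a₁₁ a₀₂ a₃₀ a₂₁ a₁₂ a₀₃ : ℝ)

theorem contDiff_cubic : ContDiff ℝ ∞ (cubic z₀ a₀₀ a₁₀ a₀₁ a₂₀ a₁₁ a₀₂ a₃₀ a₂₁ a₁₂ a₀₃) := by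
  unfold cubic
  fun_prop

@[simp] theorem cubic_self : cubic z₀ a₀₀ a₁₀ a₀₁ a₂₀ a₁₁ a₀₂ a₃₀ a₂₁ a₁₂ a₀₃ z₀ = a₀₀ := by
  simp [cubic]

-- Because the coefficients are normalized as derivatives at `z₀`, differentiation only shifts them.
-- With `cubic_self`, `simp` then evaluates any derivative at `z₀`.
@[simp] theorem Dx_cubic : Dx (cubic z₀ a₀₀ a₁₀ a₀₁ a₂₀ a₁₁ a₀₂ a₃₀ a₂₁ a₁₂ a₀₃) =
    cubic z₀ a₀₁ a₁₁ a₀₂ a₂₁ a₁₂ a₀₃ 0 0 0 0 := by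
  ext z
  have h := hasDerivAt_snd (((contDiff_cubic z₀ a₀₀ a₁₀ a₀₁ a₂₀ a₁₁ a₀₂ a₃₀ a₂₁ a₁₂
    a₀₃).differentiable (by simp)) z)
  have h2 : HasDerivAt (fun x : ℝ => x - z₀.2) 1 z.2 := (hasDerivAt_id _).sub_const _
  have h3 := (((((((((h2.const_mul a₀₁).const_add (a₀₀ + a₁₀ * (z.1 - z₀.1))).add_const
    (a₂₀ / 2 * (z.1 - z₀.1) ^ 2)).add
    (h2.const_mul (a₁₁ * (z.1 - z₀.1)))).add ((h2.pow 2).const_mul (a₀₂ / 2))).add_const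
    (a₃₀ / 6 * (z.1 - z₀.1) ^ 3)).add (h2.const_mul (a₂₁ / 2 * (z.1 - z₀.1) ^ 2))).add
    ((h2.pow 2).const_mul (a₁₂ / 2 * (z.1 - z₀.1)))).add ((h2.pow 3).const_mul (a₀₃ / 6)))
  rw [h.unique h3]
  simp [cubic]
  ring

@[simp] theorem Dt_cubic : Dt (cubic z₀ a₀₀ a₁₀ a₀₁ a₂₀ a₁₁ a₀₂ a₃₀ a₂₁ a₁₂ a₀₃) =
    cubic z₀ a₁₀ a₂₀ a₁₁ a₃₀ a₂₁ a₁₂ 0 0 0 0 := by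
  ext z
  have h := hasDerivAt_fst (((contDiff_cubic z₀ a₀₀ a₁₀ a₀₁ a₂₀ a₁₁ a₀₂ a₃₀ a₂₁ a₁₂
    a₀₃).differentiable (by simp)) z)
  have h2 : HasDerivAt (fun x : ℝ => x - z₀.1) 1 z.1 := (hasDerivAt_id _).sub_const _
  have h3 := (((((((((h2.const_mul a₁₀).const_add a₀₀).add_const (a₀₁ * (z.2 - z₀.2))).add
    ((h2.pow 2).const_mul (a₂₀ / 2))).add ((h2.const_mul a₁₁).mul_const (z.2 - z₀.2))).add_const
    (a₀₂ / 2 * (z.2 - z₀.2) ^ 2)).add ((h2.pow 3).const_mul (a₃₀ / 6))).add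
    (((h2.pow 2).const_mul (a₂₁ / 2)).mul_const (z.2 - z₀.2))).add
    ((h2.const_mul (a₁₂ / 2)).mul_const ((z.2 - z₀.2) ^ 2))).add_const
    (a₀₃ / 6 * (z.2 - z₀.2) ^ 3)
  rw [h.unique h3]
  simp [cubic]
  ring

end Cubic

/-! ### Partial derivatives in (t, x, u) and total derivatives along a graph -/

section SpaceCalculus

/-- Partial derivative `∂/∂t` of a function of `(t, x, u)`. -/
noncomputable def partialT (F : Space → ℝ) : Space → ℝ := fun p => fderiv ℝ F p (1, 0, 0)

/-- Partial derivative `∂/∂x` of a function of `(t, x, u)`. -/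
noncomputable def partialX (F : Space → ℝ) : Space → ℝ := fun p => fderiv ℝ F p (0, 1, 0)

/-- Partial derivative `∂/∂u` of a function of `(t, x, u)`. -/
noncomputable def partialU (F : Space → ℝ) : Space → ℝ := fun p => fderiv ℝ F p (0, 0, 1)

theorem clm_apply_space {E : Type*} [NormedAddCommGroup E] [NormedSpace ℝ E]
    (L : Space →L[ℝ] E) (a b c : ℝ) :
    L (a, b, c) = a • L (1, 0, 0) + b • L (0, 1, 0) + c • L (0, 0, 1) := by
  rw [← map_smul, ← map_smul, ← map_smul, ← map_add, ← map_add]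
  simp

theorem hasFDerivAt_graphPt {u : ℝ × ℝ → ℝ} {z : ℝ × ℝ} (hu : DifferentiableAt ℝ u z) :
    HasFDerivAt (graphPt u) ((ContinuousLinearMap.fst ℝ ℝ ℝ).prod
      ((ContinuousLinearMap.snd ℝ ℝ ℝ).prod (fderiv ℝ u z))) z :=
  hasFDerivAt_fst.prodMk (hasFDerivAt_snd.prodMk hu.hasFDerivAt)

theorem contDiffAt_graphPt {u : ℝ × ℝ → ℝ} {z : ℝ × ℝ} {n : WithTop ℕ∞}
    (hu : ContDiffAt ℝ n u z) : ContDiffAt ℝ n (graphPt u) z :=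
  contDiffAt_fst.prodMk (contDiffAt_snd.prodMk hu)

theorem Dt_comp_graphPt {u : ℝ × ℝ → ℝ} {z : ℝ × ℝ} {F : Space → ℝ}
    (hF : DifferentiableAt ℝ F (graphPt u z)) (hu : DifferentiableAt ℝ u z) :
    Dt (fun y => F (graphPt u y)) z =
      partialT F (graphPt u z) + partialU F (graphPt u z) * Dt u z := by
  refine (Dt_eq_of_hasFDerivAt (hF.hasFDerivAt.comp z (hasFDerivAt_graphPt hu))).trans ?_
  simp only [ContinuousLinearMap.comp_apply, ContinuousLinearMap.prod_apply,
    ContinuousLinearMap.coe_fst', ContinuousLinearMap.coe_snd']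
  rw [clm_apply_space]
  simp [partialT, partialU, Dt]; ring

theorem Dx_comp_graphPt {u : ℝ × ℝ → ℝ} {z : ℝ × ℝ} {F : Space → ℝ}
    (hF : DifferentiableAt ℝ F (graphPt u z)) (hu : DifferentiableAt ℝ u z) :
    Dx (fun y => F (graphPt u y)) z =
      partialX F (graphPt u z) + partialU F (graphPt u z) * Dx u z := by
  refine (Dx_eq_of_hasFDerivAt (hF.hasFDerivAt.comp z (hasFDerivAt_graphPt hu))).trans ?_
  simp only [ContinuousLinearMap.comp_apply, ContinuousLinearMap.prod_apply,
    ContinuousLinearMap.coe_fst', ContinuousLinearMap.coe_snd']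
  rw [clm_apply_space]
  simp [partialX, partialU, Dx]; ring

end SpaceCalculus

theorem det_plane (L : ℝ × ℝ →L[ℝ] ℝ × ℝ) :
    L.det = (L (1, 0)).1 * (L (0, 1)).2 - (L (0, 1)).1 * (L (1, 0)).2 := by
  have : L.det = LinearMap.det (L : ℝ × ℝ →ₗ[ℝ] ℝ × ℝ) := rfl
  rw [this, ← LinearMap.det_toMatrix (Module.Basis.finTwoProd ℝ), Matrix.det_fin_two]
  simp [LinearMap.toMatrix_apply]

theorem surjective_of_det_ne_zero {L : Space →L[ℝ] Space} (h : L.det ≠ 0) :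
    Function.Surjective L :=
  (L.toContinuousLinearEquivOfDetNeZero h).surjective

/-! ### Transport of graphs and of their third-order perturbations -/

section Prolongation

variable {Φ : Space → Space} {u u₀ u₁ v v₀ v₁ : ℝ × ℝ → ℝ} {z : ℝ × ℝ}

theorem contDiffAt_basePt {n : WithTop ℕ∞} (hΦ : ContDiffAt ℝ n Φ (graphPt u z))
    (hu : ContDiffAt ℝ n u z) : ContDiffAt ℝ n (basePt Φ u) z := by
  have h := hΦ.comp z (contDiffAt_graphPt hu)
  exact h.fst.prodMk h.snd.fst

theorem Dt_basePt (hΦ : DifferentiableAt ℝ Φ (graphPt u z)) (hu : DifferentiableAt ℝ u z) :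
    fderiv ℝ (basePt Φ u) z (1, 0) =
      (Dt (fun y => (Φ (graphPt u y)).1) z, Dt (fun y => (Φ (graphPt u y)).2.1) z) := by
  have h : DifferentiableAt ℝ (fun y => Φ (graphPt u y)) z :=
    hΦ.comp z (hasFDerivAt_graphPt hu).differentiableAt
  have h2 := h.fst.hasFDerivAt.prodMk h.snd.fst.hasFDerivAt
  have : HasFDerivAt (basePt Φ u) _ z := h2
  rw [this.fderiv]; rfl

theorem Dx_basePt (hΦ : DifferentiableAt ℝ Φ (graphPt u z)) (hu : DifferentiableAt ℝ u z) :
    fderiv ℝ (basePt Φ u) z (0, 1) =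
      (Dx (fun y => (Φ (graphPt u y)).1) z, Dx (fun y => (Φ (graphPt u y)).2.1) z) := by
  have h : DifferentiableAt ℝ (fun y => Φ (graphPt u y)) z :=
    hΦ.comp z (hasFDerivAt_graphPt hu).differentiableAt
  have h2 := h.fst.hasFDerivAt.prodMk h.snd.fst.hasFDerivAt
  have : HasFDerivAt (basePt Φ u) _ z := h2
  rw [this.fderiv]; rfl

/-- The image of the graph of a function is locally a graph wherever the total Jacobian is
nonzero. -/
theorem exists_carriesGerm (hΦ : ContDiffAt ℝ ∞ Φ (graphPt u z)) (hu : ContDiffAt ℝ ∞ u z)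
    (hdet : (fderiv ℝ (basePt Φ u) z).det ≠ 0) : ∃ v, CarriesGerm Φ u z v := by
  have hB : ContDiffAt ℝ ∞ (basePt Φ u) z := contDiffAt_basePt hΦ hu
  have hn : (∞ : WithTop ℕ∞) ≠ 0 := by simp
  let J := (fderiv ℝ (basePt Φ u) z).toContinuousLinearEquivOfDetNeZero hdet
  have hJ : HasFDerivAt (basePt Φ u) (J : ℝ × ℝ →L[ℝ] ℝ × ℝ) z :=
    (hB.differentiableAt hn).hasFDerivAt
  have hs : HasStrictFDerivAt (basePt Φ u) (J : ℝ × ℝ →L[ℝ] ℝ × ℝ) z :=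
    hB.hasStrictFDerivAt' hJ hn
  have hψ := hB.to_localInverse hJ hn
  set ψ := hB.localInverse hJ hn
  have hψz : ψ (basePt Φ u z) = z := hs.localInverse_apply_image
  have hleft : ∀ᶠ y in 𝓝 z, ψ (basePt Φ u y) = y := hs.eventually_left_inverse
  refine ⟨fun Y => (Φ (graphPt u (ψ Y))).2.2, hu, ?_, hdet, ?_⟩
  · have h1 : ContDiffAt ℝ ∞ (fun y => (Φ (graphPt u y)).2.2) (ψ (basePt Φ u z)) := by
      rw [hψz]
      exact (hΦ.comp z (contDiffAt_graphPt hu)).snd.snd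
    exact h1.comp _ hψ
  · filter_upwards [hleft] with y hy
    rw [hy]

/-- By the inverse function theorem the base map carries 𝓝 z onto the neighbourhood filter of the
image point, and it distorts distances to the base point only by bounded factors. -/
theorem isLittleO_pow_three_comp (hB : ContDiffAt ℝ ∞ (basePt Φ u) z)
    (hdet : (fderiv ℝ (basePt Φ u) z).det ≠ 0) {f : ℝ × ℝ → ℝ}
    (hf : (fun y => f (basePt Φ u y)) =o[𝓝 z] fun y => ‖y - z‖ ^ 3) :
    f =o[𝓝 (basePt Φ u z)] fun Y => ‖Y - basePt Φ u z‖ ^ 3 := by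
  have hn : (∞ : WithTop ℕ∞) ≠ 0 := by simp
  let J := (fderiv ℝ (basePt Φ u) z).toContinuousLinearEquivOfDetNeZero hdet
  have hJ : HasFDerivAt (basePt Φ u) (J : ℝ × ℝ →L[ℝ] ℝ × ℝ) z :=
    (hB.differentiableAt hn).hasFDerivAt
  have hs : HasStrictFDerivAt (basePt Φ u) (J : ℝ × ℝ →L[ℝ] ℝ × ℝ) z :=
    hB.hasStrictFDerivAt' hJ hn
  rw [← hs.map_nhds_eq_of_equiv, isLittleO_map]
  refine hf.trans_isBigO ?_
  exact (hJ.isTheta_sub J.toHomeomorph.isInducing).2.norm_norm.pow 3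

/-- Perturbing a function by a term of third order changes its image by a nonzero multiple of
that term, transported along the base map. -/
theorem exists_isLittleO_of_carriesGerm (hΦ : ContDiffAt ℝ ∞ Φ (graphPt u₀ z))
    (hΦd : (fderiv ℝ Φ (graphPt u₀ z)).det ≠ 0) (h₀ : CarriesGerm Φ u₀ z v₀) :
    ∃ c : ℝ, c ≠ 0 ∧ ∀ u₁ v₁ q : ℝ × ℝ → ℝ, CarriesGerm Φ u₁ z v₁ → u₁ z = u₀ z →
      (fun y => u₁ y - u₀ y) =O[𝓝 z] (fun y => ‖y - z‖ ^ 3) →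
      (fun y => q (basePt Φ u₁ y) - (u₁ y - u₀ y)) =o[𝓝 z] (fun y => ‖y - z‖ ^ 3) →
      (fun Y => v₁ Y - (v₀ Y + c * q Y)) =o[𝓝 (basePt Φ u₁ z)]
        fun Y => ‖Y - basePt Φ u₁ z‖ ^ 3 := by
  have hn : (∞ : WithTop ℕ∞) ≠ 0 := by simp
  obtain ⟨hu₀, hv₀, hdet₀, he₀⟩ := h₀
  let τ : Space → ℝ × ℝ := fun p => ((Φ p).1, (Φ p).2.1)
  -- `G` vanishes along the graph of `u₀`; along the graph of `u₁` it is `v₁ - v₀` pulled back by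
  -- the base map of `u₁`.
  let G : Space → ℝ := fun p => (Φ p).2.2 - v₀ (τ p)
  set P := graphPt u₀ z with hP
  have hτ : ContDiffAt ℝ ∞ τ P := hΦ.fst.prodMk hΦ.snd.fst
  have hv₀' : ContDiffAt ℝ ∞ v₀ (τ P) := hv₀
  have hG : ContDiffAt ℝ ∞ G P := hΦ.snd.snd.sub (hv₀'.comp P hτ)
  have hΦ' := (hΦ.differentiableAt hn).hasFDerivAt
  have hG' : ∀ d, fderiv ℝ G P d = (fderiv ℝ Φ P d).2.2 -
      fderiv ℝ v₀ (τ P) ((fderiv ℝ Φ P d).1, (fderiv ℝ Φ P d).2.1) := by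
    intro d
    have h1 : HasFDerivAt τ _ P := hΦ'.fst.prodMk hΦ'.snd.fst
    have h2 := hΦ'.snd.snd.sub
      (((hv₀'.differentiableAt hn).hasFDerivAt).comp P h1)
    have h3 : HasFDerivAt G _ P := h2
    rw [h3.fderiv]
    rfl
  have hGs : HasStrictFDerivAt G (fderiv ℝ G P) P := hG.hasStrictFDerivAt hn
  have hG0 : ∀ᶠ y in 𝓝 z, G (graphPt u₀ y) = 0 := by
    filter_upwards [he₀] with y hy
    exact sub_eq_zero.2 hy.symm
  have hu₀d := (hu₀.differentiableAt hn)
  -- The differential of `G` kills the tangent plane of the graph of `u₀`. If it killed the vertical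
  -- direction too it would be zero, but it takes the value 1 on the vector that dΦ sends to (0, 0,
  -- 1).
  have hc : fderiv ℝ G P (0, 0, 1) ≠ 0 := by
    intro hc
    obtain ⟨d, hd⟩ := surjective_of_det_ne_zero hΦd (0, 0, 1)
    have h1 : fderiv ℝ G P d = 1 := by rw [hG', hd, ← Prod.zero_eq_mk, map_zero, sub_zero]
    have h2 := hGs.hasFDerivAt.comp z (hasFDerivAt_graphPt hu₀d)
    have h3 : HasFDerivAt (G ∘ graphPt u₀) (0 : ℝ × ℝ →L[ℝ] ℝ) z :=
      (hasFDerivAt_const 0 z).congr_of_eventuallyEq hG0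
    have h4 := congrArg (fun L : ℝ × ℝ →L[ℝ] ℝ => L (d.1, d.2.1)) (h2.unique h3)
    simp only [ContinuousLinearMap.comp_apply, ContinuousLinearMap.prod_apply,
      ContinuousLinearMap.coe_fst', ContinuousLinearMap.coe_snd', zero_apply] at h4
    rw [clm_apply_space, hc] at h4
    rw [show d = (d.1, d.2.1, d.2.2) from rfl, clm_apply_space, hc] at h1
    rw [smul_zero] at h1 h4
    rw [h4] at h1
    exact zero_ne_one h1
  refine ⟨_, hc, fun u₁ v₁ q ⟨hu₁, hv₁, hdet₁, he₁⟩ hu hO ho => ?_⟩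
  have hP₁ : graphPt u₁ z = P := by simp only [hP, graphPt, hu]
  have hB₁ : ContDiffAt ℝ ∞ (basePt Φ u₁) z := contDiffAt_basePt (hP₁ ▸ hΦ) hu₁
  refine isLittleO_pow_three_comp (f := fun Y => v₁ Y - (v₀ Y + fderiv ℝ G P (0, 0, 1) * q Y))
    hB₁ hdet₁ ?_
  have t₁ : Tendsto (graphPt u₁) (𝓝 z) (𝓝 P) :=
    hP₁ ▸ (contDiffAt_graphPt hu₁).continuousAt
  have t₀ : Tendsto (graphPt u₀) (𝓝 z) (𝓝 P) := (contDiffAt_graphPt hu₀).continuousAt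
  -- Strict differentiability is essential: it bounds the error by the distance between the two
  -- graphs, which is of third order, and not merely by the distance to `P`.
  have hs := hGs.isLittleO.comp_tendsto (t₁.prodMk_nhds t₀)
  have hdiff : ∀ y, graphPt u₁ y - graphPt u₀ y = (0, 0, u₁ y - u₀ y) := fun y => by
    simp [graphPt]
  have hs' : (fun y => G (graphPt u₁ y) - G (graphPt u₀ y) -
      fderiv ℝ G P (0, 0, 1) * (u₁ y - u₀ y)) =o[𝓝 z] fun y => ‖y - z‖ ^ 3 := by
    have h1 : ∀ y, fderiv ℝ G P (graphPt u₁ y - graphPt u₀ y) =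
        fderiv ℝ G P (0, 0, 1) * (u₁ y - u₀ y) := fun y => by
      rw [hdiff, clm_apply_space]; simp [mul_comm]
    have h2 : (fun y => graphPt u₁ y - graphPt u₀ y) =O[𝓝 z] fun y => ‖y - z‖ ^ 3 := by
      refine IsBigO.trans ?_ hO
      refine IsBigO.of_bound 1 (Eventually.of_forall fun y => ?_)
      rw [hdiff]; simp
    refine (hs.trans_isBigO h2).congr_left fun y => ?_
    simp only [Function.comp]
    rw [h1]
  refine (hs'.sub (ho.const_mul_left (fderiv ℝ G P (0, 0, 1)))).congr' ?_ EventuallyEq.rfl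
  filter_upwards [hG0, he₁] with y h0 h1
  rw [h0]
  have : G (graphPt u₁ y) = v₁ (basePt Φ u₁ y) - v₀ (basePt Φ u₁ y) := by
    rw [h1]; rfl
  rw [this]
  ring

end Prolongation

/-! ### Leading terms: separation of the independent variables -/

theorem isLittleO_mul_three {α : Type*} {l : Filter α} {a₁ a₂ a₃ b₁ b₂ b₃ g : α → ℝ}
    (h₁ : (fun y => a₁ y - b₁ y) =o[l] g) (h₂ : (fun y => a₂ y - b₂ y) =o[l] g)
    (h₃ : (fun y => a₃ y - b₃ y) =o[l] g) (k₁ : b₁ =O[l] g) (k₂ : b₂ =O[l] g)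
    (k₃ : b₃ =O[l] g) :
    (fun y => a₁ y * a₂ y * a₃ y - b₁ y * b₂ y * b₃ y) =o[l] fun y => g y ^ 3 := by
  have j₂ : a₂ =O[l] g := (h₂.isBigO.add k₂).congr_left fun y => by ring
  have j₃ : a₃ =O[l] g := (h₃.isBigO.add k₃).congr_left fun y => by ring
  -- Telescoping: the factors b₁, b₂, b₃ are replaced by a₁, a₂, a₃ one at a time.
  have e₁ := (h₁.mul_isBigO j₂).mul_isBigO j₃
  have e₂ := (k₁.mul_isLittleO h₂).mul_isBigO j₃
  have e₃ := (k₁.mul k₂).mul_isLittleO h₃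
  refine ((e₁.add (e₂.congr_right fun y => ?_)).add (e₃.congr_right fun y => ?_)).congr
    (fun y => ?_) (fun y => ?_) <;> ring

theorem prod_linear_eq_cubic (z₀ z : ℝ × ℝ) (τ₁ τ₂ τ₃ ξ₁ ξ₂ ξ₃ : ℝ) :
    (τ₁ * (z.1 - z₀.1) + ξ₁ * (z.2 - z₀.2)) * (τ₂ * (z.1 - z₀.1) + ξ₂ * (z.2 - z₀.2)) *
      (τ₃ * (z.1 - z₀.1) + ξ₃ * (z.2 - z₀.2)) =
    cubic z₀ 0 0 0 0 0 0 (6 * (τ₁ * τ₂ * τ₃))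
      (2 * (τ₁ * τ₂ * ξ₃ + τ₁ * ξ₂ * τ₃ + ξ₁ * τ₂ * τ₃))
      (2 * (τ₁ * ξ₂ * ξ₃ + ξ₁ * τ₂ * ξ₃ + ξ₁ * ξ₂ * τ₃)) (6 * (ξ₁ * ξ₂ * ξ₃)) z := by
  simp only [cubic]; ring

section Leading

variable {Φ : Space → Space} {S : Set Space} {E E' : Equation} {p : Space}

/-- Cubic forms without `s y²`-term in the source variables are images of cubic forms without
`T X²`-term in the target variables, for each value of the total Jacobian matrix. -/
theorem cubic_coeff_eq_zero (hΦ : ContDiffAt ℝ ∞ Φ p) (hΦd : (fderiv ℝ Φ p).det ≠ 0)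
    (hmaps : MapsOn Φ S E E') (hp : p ∈ S) {P Q a b c d : ℝ}
    (ha : a = partialT (fun p => (Φ p).1) p + partialU (fun p => (Φ p).1) p * P)
    (hb : b = partialX (fun p => (Φ p).1) p + partialU (fun p => (Φ p).1) p * Q)
    (hc : c = partialT (fun p => (Φ p).2.1) p + partialU (fun p => (Φ p).2.1) p * P)
    (hd : d = partialX (fun p => (Φ p).2.1) p + partialU (fun p => (Φ p).2.1) p * Q)
    (hD : a * d - b * c ≠ 0) (τ₁ τ₂ τ₃ ξ₁ ξ₂ ξ₃ : ℝ)
    (hm : (τ₁ * a + ξ₁ * c) * (τ₂ * b + ξ₂ * d) * (τ₃ * b + ξ₃ * d) +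
      (τ₁ * b + ξ₁ * d) * (τ₂ * a + ξ₂ * c) * (τ₃ * b + ξ₃ * d) +
      (τ₁ * b + ξ₁ * d) * (τ₂ * b + ξ₂ * d) * (τ₃ * a + ξ₃ * c) = 0) :
    τ₁ * ξ₂ * ξ₃ + ξ₁ * τ₂ * ξ₃ + ξ₁ * ξ₂ * τ₃ = 0 := by
  obtain ⟨t₀, x₀, w₀⟩ := p
  have hn : (∞ : WithTop ℕ∞) ≠ 0 := by simp
  set z : ℝ × ℝ := (t₀, x₀) with hz
  have hI := hmaps.1 _ hp
  have hh := E.h_ne_zero _ hI.1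
  have hh' := E'.h_ne_zero _ hI.2
  simp only at hh hh'
  -- The value of u_txx that puts a jet with u = w₀, u_t = P, u_x = Q on the manifold of `E`.
  set k : ℝ := (E.l t₀ - P - w₀ * Q) / E.h t₀ with hk
  set σ₁ := τ₁ * a + ξ₁ * c
  set σ₂ := τ₂ * a + ξ₂ * c
  set σ₃ := τ₃ * a + ξ₃ * c
  set η₁ := τ₁ * b + ξ₁ * d
  set η₂ := τ₂ * b + ξ₂ * d
  set η₃ := τ₃ * b + ξ₃ * d
  let w : ℝ × ℝ → ℝ := fun y => (σ₁ * (y.1 - z.1) + η₁ * (y.2 - z.2)) *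
    (σ₂ * (y.1 - z.1) + η₂ * (y.2 - z.2)) * (σ₃ * (y.1 - z.1) + η₃ * (y.2 - z.2))
  -- `u₁` is `u₀` plus the form `w` obtained from the target form by the linear part of the base
  -- map. By `hm`, `w` has no t x² term, so both jets lie on the manifold of `E`.
  let u₀ := cubic z w₀ P Q 0 0 0 0 0 k 0
  let u₁ := cubic z w₀ P Q 0 0 0 (6 * (σ₁ * σ₂ * σ₃))
    (2 * (σ₁ * σ₂ * η₃ + σ₁ * η₂ * σ₃ + η₁ * σ₂ * σ₃)) k (6 * (η₁ * η₂ * η₃))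
  have hw : ∀ y, u₁ y - u₀ y = w y := by
    intro y
    simp only [w]
    rw [prod_linear_eq_cubic, show σ₁ * η₂ * η₃ + η₁ * σ₂ * η₃ + η₁ * η₂ * σ₃ = 0 from hm]
    simp only [u₀, u₁, cubic]
    ring
  have g₀ : graphPt u₀ z = (t₀, x₀, w₀) := by simp [graphPt, u₀, hz]
  have g₁ : graphPt u₁ z = (t₀, x₀, w₀) := by simp [graphPt, u₁, hz]
  have s₀ : ContDiff ℝ ∞ u₀ := contDiff_cubic ..
  have s₁ : ContDiff ℝ ∞ u₁ := contDiff_cubic ..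
  have hT : DifferentiableAt ℝ (fun p => (Φ p).1) (t₀, x₀, w₀) :=
    hΦ.fst.differentiableAt hn
  have hX : DifferentiableAt ℝ (fun p => (Φ p).2.1) (t₀, x₀, w₀) :=
    hΦ.snd.fst.differentiableAt hn
  have jac : ∀ u : ℝ × ℝ → ℝ, ContDiff ℝ ∞ u → graphPt u z = (t₀, x₀, w₀) → Dt u z = P →
      Dx u z = Q → fderiv ℝ (basePt Φ u) z (1, 0) = (a, c) ∧
        fderiv ℝ (basePt Φ u) z (0, 1) = (b, d) := by
    intro u su gu hP hQ
    have du := su.differentiable hn z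
    have hΦu : DifferentiableAt ℝ Φ (graphPt u z) := gu ▸ hΦ.differentiableAt hn
    rw [Dt_basePt hΦu du, Dx_basePt hΦu du]
    rw [← gu] at hT hX
    rw [Dt_comp_graphPt (F := fun p => (Φ p).1) hT du,
      Dt_comp_graphPt (F := fun p => (Φ p).2.1) hX du,
      Dx_comp_graphPt (F := fun p => (Φ p).1) hT du,
      Dx_comp_graphPt (F := fun p => (Φ p).2.1) hX du, hP, hQ, gu, ← ha, ← hb, ← hc, ← hd]
    exact ⟨rfl, rfl⟩
  obtain ⟨j₀a, j₀b⟩ := jac u₀ s₀ g₀ (by simp [u₀]) (by simp [u₀])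
  obtain ⟨j₁a, j₁b⟩ := jac u₁ s₁ g₁ (by simp [u₁]) (by simp [u₁])
  have det₀ : (fderiv ℝ (basePt Φ u₀) z).det ≠ 0 := by rw [det_plane, j₀a, j₀b]; exact hD
  have det₁ : (fderiv ℝ (basePt Φ u₁) z).det ≠ 0 := by rw [det_plane, j₁a, j₁b]; exact hD
  obtain ⟨v₀, hv₀⟩ := exists_carriesGerm (g₀ ▸ hΦ) s₀.contDiffAt det₀
  obtain ⟨v₁, hv₁⟩ := exists_carriesGerm (g₁ ▸ hΦ) s₁.contDiffAt det₁
  have hB : basePt Φ u₁ z = basePt Φ u₀ z := by simp only [basePt, g₀, g₁]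
  have E₀ : E.HoldsAt u₀ z := by
    simp only [Equation.HoldsAt, u₀, Dt_cubic, Dx_cubic, cubic_self]
    simp only [hz, hk]
    field_simp
    ring
  have E₁ : E.HoldsAt u₁ z := by
    simp only [Equation.HoldsAt, u₁, Dt_cubic, Dx_cubic, cubic_self]
    simp only [hz, hk]
    field_simp
    ring
  have E₀' := (hmaps.2 u₀ v₀ z (g₀.symm ▸ hp) hv₀).1 E₀
  have E₁' := (hmaps.2 u₁ v₁ z (g₁.symm ▸ hp) hv₁).1 E₁
  set Y := basePt Φ u₁ z with hY
  let q : ℝ × ℝ → ℝ := fun y => (τ₁ * (y.1 - Y.1) + ξ₁ * (y.2 - Y.2)) *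
    (τ₂ * (y.1 - Y.1) + ξ₂ * (y.2 - Y.2)) * (τ₃ * (y.1 - Y.1) + ξ₃ * (y.2 - Y.2))
  have lin : ∀ σ η : ℝ, (fun y : ℝ × ℝ => σ * (y.1 - z.1) + η * (y.2 - z.2)) =O[𝓝 z]
      fun y => ‖y - z‖ := by
    intro σ η
    have h1 : (fun y : ℝ × ℝ => y.1 - z.1) =O[𝓝 z] fun y => ‖y - z‖ :=
      IsBigO.of_bound 1 (Eventually.of_forall fun y => by
        simpa using norm_fst_le (y - z))
    have h2 : (fun y : ℝ × ℝ => y.2 - z.2) =O[𝓝 z] fun y => ‖y - z‖ :=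
      IsBigO.of_bound 1 (Eventually.of_forall fun y => by
        simpa using norm_snd_le (y - z))
    exact (h1.const_mul_left σ).add (h2.const_mul_left η)
  have hBd := ((contDiffAt_basePt (g₁ ▸ hΦ) s₁.contDiffAt).differentiableAt hn).hasFDerivAt
  have app : ∀ τ ξ : ℝ, (fun y : ℝ × ℝ =>
      (τ * ((basePt Φ u₁ y).1 - Y.1) + ξ * ((basePt Φ u₁ y).2 - Y.2)) -
      ((τ * a + ξ * c) * (y.1 - z.1) + (τ * b + ξ * d) * (y.2 - z.2))) =o[𝓝 z]
      fun y => ‖y - z‖ := by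
    intro τ ξ
    have h := (hasFDerivAt_iff_isLittleO.1
      ((hBd.fst.const_mul τ).add (hBd.snd.const_mul ξ))).norm_right
    refine h.congr_left fun y => ?_
    have hy : y - z = (y.1 - z.1) • ((1 : ℝ), (0 : ℝ)) + (y.2 - z.2) • ((0 : ℝ), (1 : ℝ)) := by
      ext <;> simp
    have : fderiv ℝ (basePt Φ u₁) z (y - z) =
        (y.1 - z.1) • (a, c) + (y.2 - z.2) • (b, d) := by
      rw [hy, map_add, map_smul, map_smul, j₁a, j₁b]
    simp [this, hY]
    ring
  have ho : (fun y => q (basePt Φ u₁ y) - (u₁ y - u₀ y)) =o[𝓝 z] fun y => ‖y - z‖ ^ 3 := by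
    simp only [hw]
    exact isLittleO_mul_three (app τ₁ ξ₁) (app τ₂ ξ₂) (app τ₃ ξ₃) (lin _ _) (lin _ _) (lin _ _)
  have hO : (fun y => u₁ y - u₀ y) =O[𝓝 z] fun y => ‖y - z‖ ^ 3 := by
    simp only [hw]
    refine (((lin σ₁ η₁).mul (lin σ₂ η₂)).mul (lin σ₃ η₃)).congr_right fun y => by ring
  obtain ⟨κ, hκ, key⟩ := exists_isLittleO_of_carriesGerm (g₀.symm ▸ hΦ) (g₀.symm ▸ hΦd) hv₀
  have hlo := key u₁ v₁ q hv₁ (by simp [u₀, u₁]) hO ho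
  have hq : q = cubic Y 0 0 0 0 0 0 (6 * (τ₁ * τ₂ * τ₃))
      (2 * (τ₁ * τ₂ * ξ₃ + τ₁ * ξ₂ * τ₃ + ξ₁ * τ₂ * τ₃))
      (2 * (τ₁ * ξ₂ * ξ₃ + ξ₁ * τ₂ * ξ₃ + ξ₁ * ξ₂ * τ₃)) (6 * (ξ₁ * ξ₂ * ξ₃)) := by
    ext y; exact prod_linear_eq_cubic ..
  have sv₀ : ContDiffAt ℝ ∞ v₀ Y := by rw [hB]; exact hv₀.2.1
  have sv₁ : ContDiffAt ℝ ∞ v₁ Y := hv₁.2.1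
  have sq : ContDiff ℝ ∞ q := hq ▸ contDiff_cubic ..
  have three : (3 : WithTop ℕ∞) ≤ ∞ := WithTop.coe_le_coe.2 (le_top : (3 : ℕ∞) ≤ ⊤)
  have sκ : ContDiff ℝ ∞ fun y => κ * q y := contDiff_const.mul sq
  obtain ⟨e0, e1, e2, e3⟩ := jet_eq_of_isLittleO (sv₁.of_le three)
    ((sv₀.add sκ.contDiffAt).of_le three) hlo
  obtain ⟨W, hWs, hW, hYW⟩ := mem_nhds_iff.1 ((sv₀.of_le three).eventually (by decide))
  have c0 : ContDiffOn ℝ 3 v₀ W := fun y hy => ContDiffAt.contDiffWithinAt (hWs hy)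
  have c1 : ContDiffOn ℝ 2 (Dx v₀) W := contDiffOn_Dx c0 hW (by norm_num)
  have c2 : ContDiffOn ℝ 1 (Dx (Dx v₀)) W := contDiffOn_Dx c1 hW (by norm_num)
  have dif : ∀ {F : ℝ × ℝ → ℝ}, ContDiffOn ℝ 1 F W → ∀ y ∈ W, DifferentiableAt ℝ F y :=
    fun hF y hy => (hF.contDiffAt (hW.mem_nhds hy)).differentiableAt (by norm_num)
  have dq : ∀ f : ℝ × ℝ → ℝ, ContDiff ℝ ∞ f → ∀ y, DifferentiableAt ℝ f y :=
    fun f hf y => hf.differentiable hn y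
  have sq1 : ContDiff ℝ ∞ (Dx q) := by rw [hq, Dx_cubic]; exact contDiff_cubic ..
  have sq2 : ContDiff ℝ ∞ (Dx (Dx q)) := by
    rw [hq, Dx_cubic, Dx_cubic]; exact contDiff_cubic ..
  have f1 : EqOn (Dx fun y => v₀ y + κ * q y) (fun y => Dx v₀ y + κ * Dx q y) W :=
    fun y hy => by
      rw [Dx_add (dif (c0.of_le (by norm_num)) y hy) (dq _ sκ y), Dx_const_mul _ (dq _ sq y)]
  have f2 : EqOn (Dx (Dx fun y => v₀ y + κ * q y)) (fun y => Dx (Dx v₀) y + κ * Dx (Dx q) y)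
      W := fun y hy => by
    rw [eqOn_Dx hW f1 hy, Dx_add (dif (c1.of_le (by norm_num)) y hy)
      ((dq _ sq1 y).const_mul κ), Dx_const_mul _ (dq _ sq1 y)]
  have f3 : Dt (Dx (Dx fun y => v₀ y + κ * q y)) Y =
      Dt (Dx (Dx v₀)) Y + κ * Dt (Dx (Dx q)) Y := by
    rw [eqOn_Dt hW f2 hYW, Dt_add (dif c2 Y hYW) ((dq _ sq2 Y).const_mul κ),
      Dt_const_mul _ (dq _ sq2 Y)]
  rw [f1 hYW] at e2
  rw [f3] at e3
  rw [Dt_add (dif (c0.of_le (by norm_num)) Y hYW) (dq _ sκ Y),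
    Dt_const_mul _ (dq _ sq Y)] at e1
  simp only [hq, Dx_cubic, Dt_cubic, cubic_self, mul_zero, add_zero] at e0 e1 e2 e3
  rw [← hB] at E₀'
  simp only [Equation.HoldsAt] at E₀' E₁'
  rw [e0, e1, e2, e3] at E₁'
  have hY1 : Y.1 = (Φ (t₀, x₀, w₀)).1 := by simp only [hY, basePt, g₁]
  rw [hY1] at E₀' E₁'
  -- The jets of `v₁` and `v₀` differ, in what the equation sees, only by the T X² coefficient of `κ
  -- * q`; subtracting the two target equations isolates it.
  have fin : E'.h (Φ (t₀, x₀, w₀)).1 *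
      (κ * (2 * (τ₁ * ξ₂ * ξ₃ + ξ₁ * τ₂ * ξ₃ + ξ₁ * ξ₂ * τ₃))) = 0 := by
    linear_combination E₁' - E₀'
  simpa [hh', hκ] using fin

theorem totalDeriv_eq_zero (hΦ : ContDiffAt ℝ ∞ Φ p) (hΦd : (fderiv ℝ Φ p).det ≠ 0)
    (hmaps : MapsOn Φ S E E') (hp : p ∈ S) {P Q a b c d : ℝ}
    (ha : a = partialT (fun p => (Φ p).1) p + partialU (fun p => (Φ p).1) p * P)
    (hb : b = partialX (fun p => (Φ p).1) p + partialU (fun p => (Φ p).1) p * Q)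
    (hc : c = partialT (fun p => (Φ p).2.1) p + partialU (fun p => (Φ p).2.1) p * P)
    (hd : d = partialX (fun p => (Φ p).2.1) p + partialU (fun p => (Φ p).2.1) p * Q)
    (hD : a * d - b * c ≠ 0) : b = 0 ∧ c = 0 := by
  have key := cubic_coeff_eq_zero hΦ hΦd hmaps hp ha hb hc hd hD
  -- With D = ad - bc, the linear forms dT - bX and -cT + aX pull back to D t and D x. The three
  -- choices thus pull back to D³t³, D³x³ and D³t²x, none with a t x² term.
  have k₁ := key d d d (-b) (-b) (-b) (by ring)
  have k₂ := key (-c) (-c) (-c) a a a (by ring)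
  have k₃ := key d d (-c) (-b) (-b) a (by ring)
  have hb0 : b = 0 := by
    by_contra hb0
    have hd0 : d = 0 := by
      have : b ^ 2 * d = 0 := by linear_combination k₁ / 3
      simpa [hb0] using this
    have hc0 : c = 0 := by
      have : b ^ 2 * c = 0 := by linear_combination -k₃ - 2 * b * a * hd0
      simpa [hb0] using this
    exact hD (by rw [hd0, hc0]; ring)
  have ha0 : a ≠ 0 := fun ha0 => hD (by rw [ha0, hb0]; ring)
  refine ⟨hb0, ?_⟩
  have : a ^ 2 * c = 0 := by linear_combination -k₂ / 3
  simpa [ha0] using this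

/-- The `t`-component depends only on `t`, the `x`-component only on `x`. -/
theorem partial_eq_zero (hΦ : ContDiffAt ℝ ∞ Φ p) (hΦd : (fderiv ℝ Φ p).det ≠ 0)
    (hmaps : MapsOn Φ S E E') (hp : p ∈ S) :
    partialX (fun p => (Φ p).1) p = 0 ∧ partialU (fun p => (Φ p).1) p = 0 ∧
    partialT (fun p => (Φ p).2.1) p = 0 ∧ partialU (fun p => (Φ p).2.1) p = 0 := by
  have hn : (∞ : WithTop ℕ∞) ≠ 0 := by simp
  have hd := (hΦ.differentiableAt hn).hasFDerivAt
  have key := fun P Q : ℝ => totalDeriv_eq_zero (P := P) (Q := Q) hΦ hΦd hmaps hp rfl rfl rfl rfl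
  obtain ⟨e, he⟩ := surjective_of_det_ne_zero hΦd (1, 0, 0)
  obtain ⟨f, hf⟩ := surjective_of_det_ne_zero hΦd (0, 1, 0)
  have hT : ∀ w, (fderiv ℝ Φ p w).1 = fderiv ℝ (fun p => (Φ p).1) p w := fun w => by
    rw [hd.fst.fderiv]; rfl
  have hX : ∀ w, (fderiv ℝ Φ p w).2.1 = fderiv ℝ (fun p => (Φ p).2.1) p w := fun w => by
    rw [hd.snd.fst.fderiv]; rfl
  have e1 := hT e
  have e2 := hX e
  have f1 := hT f
  have f2 := hX f
  rw [he, show e = (e.1, e.2.1, e.2.2) from rfl, clm_apply_space] at e1 e2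
  rw [hf, show f = (f.1, f.2.1, f.2.2) from rfl, clm_apply_space] at f1 f2
  change 1 = e.1 * partialT (fun p => (Φ p).1) p + e.2.1 * partialX (fun p => (Φ p).1) p +
    e.2.2 * partialU (fun p => (Φ p).1) p at e1
  change 0 = e.1 * partialT (fun p => (Φ p).2.1) p + e.2.1 * partialX (fun p => (Φ p).2.1) p +
    e.2.2 * partialU (fun p => (Φ p).2.1) p at e2
  change 0 = f.1 * partialT (fun p => (Φ p).1) p + f.2.1 * partialX (fun p => (Φ p).1) p +
    f.2.2 * partialU (fun p => (Φ p).1) p at f1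
  change 1 = f.1 * partialT (fun p => (Φ p).2.1) p + f.2.1 * partialX (fun p => (Φ p).2.1) p +
    f.2.2 * partialU (fun p => (Φ p).2.1) p at f2
  generalize partialT (fun p => (Φ p).1) p = Tt at *
  generalize partialX (fun p => (Φ p).1) p = Tx at *
  generalize partialU (fun p => (Φ p).1) p = Tu at *
  generalize partialT (fun p => (Φ p).2.1) p = Xt at *
  generalize partialX (fun p => (Φ p).2.1) p = Xx at *
  generalize partialU (fun p => (Φ p).2.1) p = Xu at *
  -- Cauchy–Binet: d(T, X) sends `e`, `f` to the standard basis of the plane, so the three 2×2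
  -- minors of its matrix cannot all vanish.
  have minors : 1 = (Tt * Xx - Tx * Xt) * (e.1 * f.2.1 - e.2.1 * f.1) +
      (Tu * Xx - Tx * Xu) * (e.2.2 * f.2.1 - e.2.1 * f.2.2) +
      (Tt * Xu - Tu * Xt) * (e.1 * f.2.2 - e.2.2 * f.1) := by
    linear_combination (f.1 * Xt + f.2.1 * Xx + f.2.2 * Xu) * e1 + f2 -
      (f.1 * Tt + f.2.1 * Tx + f.2.2 * Tu) * e2
  -- the total Jacobian is an affine function `α + β P + γ Q` of the first derivatives
  set α := Tt * Xx - Tx * Xt with hα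
  set β := Tu * Xx - Tx * Xu with hβ
  set γ := Tt * Xu - Tu * Xt with hγ
  have hne : ¬ (α = 0 ∧ β = 0 ∧ γ = 0) := by
    rintro ⟨h1, h2, h3⟩
    rw [h1, h2, h3] at minors
    norm_num at minors
  -- Multiplying by the total Jacobian removes the nondegeneracy condition. The result is a
  -- polynomial identity for all P and Q, and its coefficients are recovered from a few values.
  have prod : ∀ P Q : ℝ, (α + β * P + γ * Q) * (Tx + Tu * Q) = 0 ∧
      (α + β * P + γ * Q) * (Xt + Xu * P) = 0 := by
    intro P Q
    by_cases h : α + β * P + γ * Q = 0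
    · simp [h]
    · have := key P Q (by
        intro h'; apply h; rw [← h', hα, hβ, hγ]; ring)
      simp [this.1, this.2]
  have hTu : Tu = 0 := by
    by_contra h
    have p1 := (prod 0 0).1
    have p2 := (prod 0 1).1
    have p3 := (prod 0 (-1)).1
    have p4 := (prod 1 0).1
    have p5 := (prod 1 1).1
    have g0 : γ = 0 := by
      have : Tu * γ = 0 := by linear_combination (p2 + p3) / 2 - p1
      simpa [h] using this
    have b0 : β = 0 := by
      have : Tu * β = 0 := by linear_combination p5 - p4 - p2 + p1
      simpa [h] using this
    refine hne ⟨?_, b0, g0⟩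
    have : Tu * α = 0 := by linear_combination p2 - p1 - (Tx + Tu) * g0
    simpa [h] using this
  have hXu : Xu = 0 := by
    by_contra h
    have p1 := (prod 0 0).2
    have p2 := (prod 1 0).2
    have p3 := (prod (-1) 0).2
    have p4 := (prod 0 1).2
    have p5 := (prod 1 1).2
    have g0 : β = 0 := by
      have : Xu * β = 0 := by linear_combination (p2 + p3) / 2 - p1
      simpa [h] using this
    have b0 : γ = 0 := by
      have : Xu * γ = 0 := by linear_combination p5 - p4 - p2 + p1
      simpa [h] using this
    refine hne ⟨?_, g0, b0⟩
    have : Xu * α = 0 := by linear_combination p2 - p1 - (Xt + Xu) * g0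
    simpa [h] using this
  have b0 : β = 0 := by rw [hβ, hTu, hXu]; ring
  have g0 : γ = 0 := by rw [hγ, hTu, hXu]; ring
  have a0 : α ≠ 0 := fun a0 => hne ⟨a0, b0, g0⟩
  have p1 := (prod 0 0).1
  have p2 := (prod 0 0).2
  simp only [mul_zero, add_zero] at p1 p2
  exact ⟨(mul_eq_zero.1 p1).resolve_left a0, hTu, (mul_eq_zero.1 p2).resolve_left a0, hXu⟩

end Leading

/-! ### Symmetry of partial derivatives and substitution of a jet -/

section SmoothOnSpace

variable {Ω : Set Space} {F : Space → ℝ} {p : Space}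

theorem contDiffOn_partialT (hF : ContDiffOn ℝ ∞ F Ω) (hΩ : IsOpen Ω) :
    ContDiffOn ℝ ∞ (partialT F) Ω :=
  (hF.fderiv_of_isOpen hΩ le_rfl).clm_apply contDiffOn_const

theorem contDiffOn_partialX (hF : ContDiffOn ℝ ∞ F Ω) (hΩ : IsOpen Ω) :
    ContDiffOn ℝ ∞ (partialX F) Ω :=
  (hF.fderiv_of_isOpen hΩ le_rfl).clm_apply contDiffOn_const

theorem contDiffOn_partialU (hF : ContDiffOn ℝ ∞ F Ω) (hΩ : IsOpen Ω) :
    ContDiffOn ℝ ∞ (partialU F) Ω :=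
  (hF.fderiv_of_isOpen hΩ le_rfl).clm_apply contDiffOn_const

theorem differentiableAt_of_contDiffOn (hF : ContDiffOn ℝ ∞ F Ω) (hΩ : IsOpen Ω) (hp : p ∈ Ω) :
    DifferentiableAt ℝ F p :=
  (hF.contDiffAt (hΩ.mem_nhds hp)).differentiableAt (by simp)

theorem fderiv_eq_of_eqOn {G : Space → ℝ} (hΩ : IsOpen Ω) (h : EqOn F G Ω) (hp : p ∈ Ω) :
    fderiv ℝ F p = fderiv ℝ G p :=
  (h.eventuallyEq_of_mem (hΩ.mem_nhds hp)).fderiv_eq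

theorem partial_eq_zero_of_eqOn_zero (hΩ : IsOpen Ω) (h : ∀ p ∈ Ω, F p = 0) (hp : p ∈ Ω) :
    partialT F p = 0 ∧ partialX F p = 0 ∧ partialU F p = 0 := by
  have : fderiv ℝ F p = fderiv ℝ (fun _ => (0 : ℝ)) p := fderiv_eq_of_eqOn hΩ h hp
  simp only [partialT, partialX, partialU, this]
  simp

theorem fderiv_fderiv_comm (hF : ContDiffOn ℝ ∞ F Ω) (hΩ : IsOpen Ω) (hp : p ∈ Ω) (a b : Space) :
    fderiv ℝ (fun q => fderiv ℝ F q a) p b = fderiv ℝ (fun q => fderiv ℝ F q b) p a := by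
  have hs : IsSymmSndFDerivAt ℝ F p :=
    (hF.contDiffAt (hΩ.mem_nhds hp)).isSymmSndFDerivAt (by
      simpa using WithTop.coe_le_coe.2 (le_top : (2 : ℕ∞) ≤ ⊤))
  have hd : DifferentiableAt ℝ (fderiv ℝ F) p :=
    ((hF.fderiv_of_isOpen hΩ (m := ∞) le_rfl).contDiffAt (hΩ.mem_nhds hp)).differentiableAt
      (by simp)
  have e : ∀ a b, fderiv ℝ (fun q => fderiv ℝ F q a) p b = fderiv ℝ (fderiv ℝ F) p b a := by
    intro a b
    rw [fderiv_clm_apply hd (differentiableAt_const a)]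
    simp
  rw [e, e]
  exact hs b a

theorem partialT_partialX_comm (hF : ContDiffOn ℝ ∞ F Ω) (hΩ : IsOpen Ω) (hp : p ∈ Ω) :
    partialT (partialX F) p = partialX (partialT F) p := fderiv_fderiv_comm hF hΩ hp _ _

theorem partialU_partialX_comm (hF : ContDiffOn ℝ ∞ F Ω) (hΩ : IsOpen Ω) (hp : p ∈ Ω) :
    partialU (partialX F) p = partialX (partialU F) p := fderiv_fderiv_comm hF hΩ hp _ _

theorem partialT_partialU_comm (hF : ContDiffOn ℝ ∞ F Ω) (hΩ : IsOpen Ω) (hp : p ∈ Ω) :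
    partialT (partialU F) p = partialU (partialT F) p := fderiv_fderiv_comm hF hΩ hp _ _

theorem fderiv_eq_zero_of_partial (ht : partialT F p = 0) (hx : partialX F p = 0)
    (hu : partialU F p = 0) : fderiv ℝ F p = 0 := by
  refine ContinuousLinearMap.ext fun d => ?_
  rw [show d = (d.1, d.2.1, d.2.2) from rfl, clm_apply_space]
  simp only [partialT, partialX, partialU] at ht hx hu
  rw [ht, hx, hu]
  simp

/-- Derivatives of the substitution of a function `u` into a function of `(t, x, u)`. -/
theorem jet_comp_graphPt (hF : ContDiffOn ℝ ∞ F Ω) (hΩ : IsOpen Ω) {u : ℝ × ℝ → ℝ}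
    (hu : ContDiff ℝ ∞ u) {z : ℝ × ℝ} (hp : graphPt u z = p) (hz : p ∈ Ω) {a b m n k : ℝ}
    (ha : Dt u z = a) (hb : Dx u z = b) (hm : Dx (Dx u) z = m) (hn : Dt (Dx u) z = n)
    (hk : Dt (Dx (Dx u)) z = k) :
    Dt (fun y => F (graphPt u y)) z = partialT F p + partialU F p * a ∧
    Dx (fun y => F (graphPt u y)) z = partialX F p + partialU F p * b ∧
    Dt (Dx fun y => F (graphPt u y)) z =
      partialT (partialX F) p + partialU (partialX F) p * a +
      ((partialT (partialU F) p + partialU (partialU F) p * a) * b + partialU F p * n) ∧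
    Dt (Dx (Dx fun y => F (graphPt u y))) z =
      partialT (partialX (partialX F)) p + partialU (partialX (partialX F)) p * a +
      ((partialT (partialU (partialX F)) p + partialU (partialU (partialX F)) p * a) * b +
        partialU (partialX F) p * n) +
      (((partialT (partialX (partialU F)) p + partialU (partialX (partialU F)) p * a +
        ((partialT (partialU (partialU F)) p + partialU (partialU (partialU F)) p * a) * b +
          partialU (partialU F) p * n)) * b +
        (partialX (partialU F) p + partialU (partialU F) p * b) * n) +
      ((partialT (partialU F) p + partialU (partialU F) p * a) * m + partialU F p * k)) := by
  have hn0 : (∞ : WithTop ℕ∞) ≠ 0 := by simp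
  subst ha hb hm hn hk hp
  have hg : ContDiff ℝ ∞ (graphPt u) := contDiff_fst.prodMk (contDiff_snd.prodMk hu)
  set W : Set (ℝ × ℝ) := graphPt u ⁻¹' Ω
  have hW : IsOpen W := hΩ.preimage hg.continuous
  have hFX := contDiffOn_partialX hF hΩ
  have hFU := contDiffOn_partialU hF hΩ
  have hFXX := contDiffOn_partialX hFX hΩ
  have hFUX := contDiffOn_partialU hFX hΩ
  have hFXU := contDiffOn_partialX hFU hΩ
  have hFUU := contDiffOn_partialU hFU hΩ
  have d : ∀ {G : Space → ℝ}, ContDiffOn ℝ ∞ G Ω → ∀ y ∈ W,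
      DifferentiableAt ℝ G (graphPt u y) := fun hG y hy =>
    differentiableAt_of_contDiffOn hG hΩ hy
  have dg : ∀ {G : Space → ℝ}, ContDiffOn ℝ ∞ G Ω → ∀ y ∈ W,
      DifferentiableAt ℝ (fun y => G (graphPt u y)) y := fun hG y hy =>
    (d hG y hy).comp y (hg.differentiable hn0 y)
  have du := fun y => hu.differentiable hn0 y
  have hux : ContDiff ℝ ∞ (Dx u) :=
    contDiffOn_univ.1 (contDiffOn_Dx hu.contDiffOn isOpen_univ le_rfl)
  have huxx : ContDiff ℝ ∞ (Dx (Dx u)) :=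
    contDiffOn_univ.1 (contDiffOn_Dx hux.contDiffOn isOpen_univ le_rfl)
  have dux := fun y => hux.differentiable hn0 y
  have duxx := fun y => huxx.differentiable hn0 y
  have e1 : EqOn (Dx fun y => F (graphPt u y))
      (fun y => partialX F (graphPt u y) + partialU F (graphPt u y) * Dx u y) W :=
    fun y hy => Dx_comp_graphPt (d hF y hy) (du y)
  have e2 : EqOn (Dx (Dx fun y => F (graphPt u y)))
      (fun y => partialX (partialX F) (graphPt u y) +
        partialU (partialX F) (graphPt u y) * Dx u y +
        ((partialX (partialU F) (graphPt u y) + partialU (partialU F) (graphPt u y) * Dx u y) *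
          Dx u y + partialU F (graphPt u y) * Dx (Dx u) y)) W := fun y hy => by
    rw [eqOn_Dx hW e1 hy, Dx_add (dg hFX y hy) ((dg hFU y hy).fun_mul (dux y)),
      Dx_mul (dg hFU y hy) (dux y), Dx_comp_graphPt (d hFX y hy) (du y),
      Dx_comp_graphPt (d hFU y hy) (du y)]
  refine ⟨Dt_comp_graphPt (d hF z hz) (du z), e1 hz, ?_, ?_⟩
  · rw [eqOn_Dt hW e1 hz, Dt_add (dg hFX z hz) ((dg hFU z hz).fun_mul (dux z)),
      Dt_mul (dg hFU z hz) (dux z), Dt_comp_graphPt (d hFX z hz) (du z),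
      Dt_comp_graphPt (d hFU z hz) (du z)]
  · have q1 := (dg hFUX z hz).fun_mul (dux z)
    have q2 := (dg hFXU z hz).fun_add ((dg hFUU z hz).fun_mul (dux z))
    have q3 := (dg hFU z hz).fun_mul (duxx z)
    rw [eqOn_Dt hW e2 hz, Dt_add ((dg hFXX z hz).fun_add q1) ((q2.fun_mul (dux z)).fun_add q3),
      Dt_add (dg hFXX z hz) q1, Dt_add (q2.fun_mul (dux z)) q3, Dt_mul (dg hFUX z hz) (dux z),
      Dt_mul q2 (dux z), Dt_add (dg hFXU z hz) ((dg hFUU z hz).fun_mul (dux z)),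
      Dt_mul (dg hFUU z hz) (dux z), Dt_mul (dg hFU z hz) (duxx z),
      Dt_comp_graphPt (d hFXX z hz) (du z), Dt_comp_graphPt (d hFUX z hz) (du z),
      Dt_comp_graphPt (d hFXU z hz) (du z), Dt_comp_graphPt (d hFUU z hz) (du z),
      Dt_comp_graphPt (d hFU z hz) (du z)]

end SmoothOnSpace

/-! ### Prolongation when T depends on t only and X on x only -/

section Separated

variable {Φ : Space → Space} {Ω : Set Space} {u v : ℝ × ℝ → ℝ} {z : ℝ × ℝ}

/-- The `t`-component depends (locally) only on `t`, the `x`-component only on `x`. -/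
structure Separated (Φ : Space → Space) (Ω : Set Space) : Prop where
  isOpen : IsOpen Ω
  smooth : ContDiffOn ℝ ∞ Φ Ω
  fst_X : ∀ p ∈ Ω, partialX (fun p => (Φ p).1) p = 0
  fst_U : ∀ p ∈ Ω, partialU (fun p => (Φ p).1) p = 0
  snd_T : ∀ p ∈ Ω, partialT (fun p => (Φ p).2.1) p = 0
  snd_U : ∀ p ∈ Ω, partialU (fun p => (Φ p).2.1) p = 0

theorem Separated.comp_basePt (hΦ : Separated Φ Ω) (hu : DifferentiableAt ℝ u z)
    (hz : graphPt u z ∈ Ω) {f : ℝ × ℝ → ℝ} (hf : DifferentiableAt ℝ f (basePt Φ u z)) :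
    Dt (fun y => f (basePt Φ u y)) z =
      Dt f (basePt Φ u z) * partialT (fun p => (Φ p).1) (graphPt u z) ∧
    Dx (fun y => f (basePt Φ u y)) z =
      Dx f (basePt Φ u z) * partialX (fun p => (Φ p).2.1) (graphPt u z) := by
  have hd : DifferentiableAt ℝ Φ (graphPt u z) :=
    (hΦ.smooth.contDiffAt (hΦ.isOpen.mem_nhds hz)).differentiableAt (by simp)
  have hB : DifferentiableAt ℝ (basePt Φ u) z := by
    have h : DifferentiableAt ℝ (fun y => Φ (graphPt u y)) z :=
      hd.comp z (hasFDerivAt_graphPt hu).differentiableAt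
    exact h.fst.prodMk h.snd.fst
  have hc := hf.hasFDerivAt.comp z hB.hasFDerivAt
  have e : ∀ a b : ℝ, fderiv ℝ f (basePt Φ u z) (a, b) =
      Dt f (basePt Φ u z) * a + Dx f (basePt Φ u z) * b := by
    intro a b
    have : ((a, b) : ℝ × ℝ) = a • ((1 : ℝ), (0 : ℝ)) + b • ((0 : ℝ), (1 : ℝ)) := by
      ext <;> simp
    rw [this, map_add, map_smul, map_smul]
    simp [Dt, Dx, mul_comm]
  constructor
  · refine (Dt_eq_of_hasFDerivAt hc).trans ?_
    rw [ContinuousLinearMap.comp_apply, Dt_basePt hd hu, e,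
      Dt_comp_graphPt (F := fun p => (Φ p).1) hd.fst hu,
      Dt_comp_graphPt (F := fun p => (Φ p).2.1) hd.snd.fst hu, hΦ.fst_U _ hz, hΦ.snd_T _ hz,
      hΦ.snd_U _ hz]
    ring
  · refine (Dx_eq_of_hasFDerivAt hc).trans ?_
    rw [ContinuousLinearMap.comp_apply, Dx_basePt hd hu, e,
      Dx_comp_graphPt (F := fun p => (Φ p).1) hd.fst hu,
      Dx_comp_graphPt (F := fun p => (Φ p).2.1) hd.snd.fst hu, hΦ.fst_U _ hz, hΦ.fst_X _ hz,
      hΦ.snd_U _ hz]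
    ring

/-- Prolongation of a point transformation with separated components for the independent
variables. -/
theorem Separated.jet (hΦ : Separated Φ Ω) (hz : graphPt u z ∈ Ω) (hv : CarriesGerm Φ u z v)
    {Y : ℝ × ℝ} (hY : Y = basePt Φ u z) {T₁ X₁ X₂ : ℝ}
    (hT₁ : T₁ = partialT (fun p => (Φ p).1) (graphPt u z))
    (hX₁ : X₁ = partialX (fun p => (Φ p).2.1) (graphPt u z))
    (hX₂ : X₂ = partialX (partialX fun p => (Φ p).2.1) (graphPt u z)) :
    (Φ (graphPt u z)).2.2 = v Y ∧
    Dt (fun y => (Φ (graphPt u y)).2.2) z = Dt v Y * T₁ ∧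
    Dx (fun y => (Φ (graphPt u y)).2.2) z = Dx v Y * X₁ ∧
    Dt (Dx fun y => (Φ (graphPt u y)).2.2) z = Dt (Dx v) Y * T₁ * X₁ ∧
    Dt (Dx (Dx fun y => (Φ (graphPt u y)).2.2)) z =
      Dt (Dx (Dx v)) Y * T₁ * X₁ ^ 2 + Dt (Dx v) Y * T₁ * X₂ := by
  subst hY hT₁ hX₁ hX₂
  obtain ⟨hu, hv, -, he⟩ := hv
  have three : (3 : WithTop ℕ∞) ≤ ∞ := WithTop.coe_le_coe.2 (le_top : (3 : ℕ∞) ≤ ⊤)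
  obtain ⟨V, hVs, hV, hzV⟩ := mem_nhds_iff.1 ((hv.of_le three).eventually (by decide))
  have hΦz : ContDiffAt ℝ ∞ Φ (graphPt u z) := hΦ.smooth.contDiffAt (hΦ.isOpen.mem_nhds hz)
  have ev1 : ∀ᶠ y in 𝓝 z, graphPt u y ∈ Ω :=
    (contDiffAt_graphPt hu).continuousAt.eventually_mem (hΦ.isOpen.mem_nhds hz)
  have ev2 : ∀ᶠ y in 𝓝 z, basePt Φ u y ∈ V :=
    (contDiffAt_basePt hΦz hu).continuousAt.eventually_mem (hV.mem_nhds hzV)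
  obtain ⟨W, hWs, hW, hzW⟩ := mem_nhds_iff.1
    ((((hu.of_le three).eventually (by decide)).and ev1).and (ev2.and he))
  have du : ∀ y ∈ W, DifferentiableAt ℝ u y := fun y hy =>
    (hWs hy).1.1.differentiableAt (by norm_num)
  have hgΩ : ∀ y ∈ W, graphPt u y ∈ Ω := fun y hy => (hWs hy).1.2
  have hBV : ∀ y ∈ W, basePt Φ u y ∈ V := fun y hy => (hWs hy).2.1
  have c0 : ContDiffOn ℝ 3 v V := fun y hy => ContDiffAt.contDiffWithinAt (hVs hy)
  have c1 : ContDiffOn ℝ 2 (Dx v) V := contDiffOn_Dx c0 hV (by norm_num)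
  have c2 : ContDiffOn ℝ 1 (Dx (Dx v)) V := contDiffOn_Dx c1 hV (by norm_num)
  have dif : ∀ {f : ℝ × ℝ → ℝ}, ContDiffOn ℝ 1 f V → ∀ y ∈ W,
      DifferentiableAt ℝ f (basePt Φ u y) := fun hf y hy =>
    (hf.contDiffAt (hV.mem_nhds (hBV y hy))).differentiableAt (by norm_num)
  have dB : ∀ y ∈ W, DifferentiableAt ℝ (basePt Φ u) y := fun y hy =>
    (contDiffAt_basePt ((hΦ.smooth.contDiffAt (hΦ.isOpen.mem_nhds (hgΩ y hy))).of_le three)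
      (hWs hy).1.1).differentiableAt (by norm_num)
  have hX : ContDiffOn ℝ ∞ (fun p => (Φ p).2.1) Ω := hΦ.smooth.snd.fst
  set ξ := partialX fun p => (Φ p).2.1 with hξ
  have cξ : ContDiffOn ℝ ∞ ξ Ω := contDiffOn_partialX hX hΦ.isOpen
  have cξ' : ContDiffOn ℝ ∞ (partialX ξ) Ω := contDiffOn_partialX cξ hΦ.isOpen
  -- Commuting partial derivatives makes X_x and X_xx independent of t and u, so neither contributes
  -- when the relations between `u` and `v` are differentiated in t.
  have ξT : ∀ p ∈ Ω, partialT ξ p = 0 := fun p hp => by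
    rw [hξ, partialT_partialX_comm hX hΦ.isOpen hp]
    exact (partial_eq_zero_of_eqOn_zero hΦ.isOpen hΦ.snd_T hp).2.1
  have ξU : ∀ p ∈ Ω, partialU ξ p = 0 := fun p hp => by
    rw [hξ, partialU_partialX_comm hX hΦ.isOpen hp]
    exact (partial_eq_zero_of_eqOn_zero hΦ.isOpen hΦ.snd_U hp).2.1
  have ξ'T : ∀ p ∈ Ω, partialT (partialX ξ) p = 0 := fun p hp => by
    rw [partialT_partialX_comm cξ hΦ.isOpen hp]
    exact (partial_eq_zero_of_eqOn_zero hΦ.isOpen ξT hp).2.1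
  have ξ'U : ∀ p ∈ Ω, partialU (partialX ξ) p = 0 := fun p hp => by
    rw [partialU_partialX_comm cξ hΦ.isOpen hp]
    exact (partial_eq_zero_of_eqOn_zero hΦ.isOpen ξU hp).2.1
  have dg : ∀ {G : Space → ℝ}, ContDiffOn ℝ ∞ G Ω → ∀ y ∈ W,
      DifferentiableAt ℝ (fun y => G (graphPt u y)) y := fun hG y hy =>
    (differentiableAt_of_contDiffOn hG hΦ.isOpen (hgΩ y hy)).comp y
      (hasFDerivAt_graphPt (du y hy)).differentiableAt
  have ξt : ∀ y ∈ W, Dt (fun y => ξ (graphPt u y)) y = 0 := fun y hy => by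
    rw [Dt_comp_graphPt (differentiableAt_of_contDiffOn cξ hΦ.isOpen (hgΩ y hy)) (du y hy),
      ξT _ (hgΩ y hy), ξU _ (hgΩ y hy)]
    ring
  have ξx : ∀ y ∈ W, Dx (fun y => ξ (graphPt u y)) y = partialX ξ (graphPt u y) :=
    fun y hy => by
      rw [Dx_comp_graphPt (differentiableAt_of_contDiffOn cξ hΦ.isOpen (hgΩ y hy)) (du y hy),
        ξU _ (hgΩ y hy)]
      ring
  have ξ't : ∀ y ∈ W, Dt (fun y => partialX ξ (graphPt u y)) y = 0 := fun y hy => by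
    rw [Dt_comp_graphPt (differentiableAt_of_contDiffOn cξ' hΦ.isOpen (hgΩ y hy)) (du y hy),
      ξ'T _ (hgΩ y hy), ξ'U _ (hgΩ y hy)]
    ring
  have ch : ∀ {f : ℝ × ℝ → ℝ}, ContDiffOn ℝ 1 f V → ∀ y ∈ W, _ ∧ _ := fun hf y hy =>
    hΦ.comp_basePt (du y hy) (hgΩ y hy) (dif hf y hy)
  have dc : ∀ {f : ℝ × ℝ → ℝ}, ContDiffOn ℝ 1 f V → ∀ y ∈ W,
      DifferentiableAt ℝ (fun y => f (basePt Φ u y)) y := fun hf y hy =>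
    (dif hf y hy).comp y (dB y hy)
  have o0 : ContDiffOn ℝ 1 v V := c0.of_le (by norm_num)
  have o1 : ContDiffOn ℝ 1 (Dx v) V := c1.of_le (by norm_num)
  have e0 : EqOn (fun y => (Φ (graphPt u y)).2.2) (fun y => v (basePt Φ u y)) W :=
    fun y hy => (hWs hy).2.2.symm
  have e1 : EqOn (Dx fun y => (Φ (graphPt u y)).2.2)
      (fun y => Dx v (basePt Φ u y) * ξ (graphPt u y)) W := fun y hy => by
    rw [eqOn_Dx hW e0 hy, (ch o0 y hy).2]
  have e2 : EqOn (Dx (Dx fun y => (Φ (graphPt u y)).2.2))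
      (fun y => Dx (Dx v) (basePt Φ u y) * (ξ (graphPt u y) * ξ (graphPt u y)) +
        Dx v (basePt Φ u y) * partialX ξ (graphPt u y)) W := fun y hy => by
    rw [eqOn_Dx hW e1 hy, Dx_mul (dc o1 y hy) (dg cξ y hy), (ch o1 y hy).2, ξx y hy]
    ring
  refine ⟨e0 hzW, ?_, e1 hzW, ?_, ?_⟩
  · rw [eqOn_Dt hW e0 hzW, (ch o0 z hzW).1]
  · rw [eqOn_Dt hW e1 hzW, Dt_mul (dc o1 z hzW) (dg cξ z hzW), (ch o1 z hzW).1, ξt z hzW]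
    ring
  · have dξξ := (dg cξ z hzW).fun_mul (dg cξ z hzW)
    rw [eqOn_Dt hW e2 hzW, Dt_add ((dc c2 z hzW).fun_mul dξξ)
        ((dc o1 z hzW).fun_mul (dg cξ' z hzW)),
      Dt_mul (dc c2 z hzW) dξξ, Dt_mul (dg cξ z hzW) (dg cξ z hzW),
      Dt_mul (dc o1 z hzW) (dg cξ' z hzW), (ch c2 z hzW).1, (ch o1 z hzW).1, ξt z hzW,
      ξ't z hzW]
    ring

end Separated

/-! ### Dependence on u along vertical segments -/

section VerticalLines

variable {Ω : Set Space} {F : Space → ℝ} {p : Space}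

theorem hasDerivAt_vertical (hF : DifferentiableAt ℝ F p) :
    HasDerivAt (fun s => F (p.1, p.2.1, s)) (partialU F p) p.2.2 := by
  have h : HasDerivAt (fun s : ℝ => ((p.1, p.2.1, s) : Space)) (0, 0, 1) p.2.2 :=
    (hasDerivAt_const _ _).prodMk ((hasDerivAt_const _ _).prodMk (hasDerivAt_id _))
  exact hF.hasFDerivAt.comp_hasDerivAt p.2.2 h

theorem eventually_vertical_mem (hΩ : IsOpen Ω) (hp : p ∈ Ω) :
    ∀ᶠ s in 𝓝 p.2.2, ((p.1, p.2.1, s) : Space) ∈ Ω := by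
  have : ContinuousAt (fun s : ℝ => ((p.1, p.2.1, s) : Space)) p.2.2 := by fun_prop
  exact this.eventually_mem (hΩ.mem_nhds hp)

/-- A vertical line may meet Ω in several pieces, so constancy is only local. That is enough to
compare coefficients of powers of u at a fixed (t, x). -/
theorem eventually_vertical_eq (hF : ContDiffOn ℝ ∞ F Ω) (hΩ : IsOpen Ω)
    (h0 : ∀ p ∈ Ω, partialU F p = 0) (hp : p ∈ Ω) :
    ∀ᶠ s in 𝓝 p.2.2, F (p.1, p.2.1, s) = F p := by
  obtain ⟨r, hr, hball⟩ := Metric.mem_nhds_iff.1 (eventually_vertical_mem hΩ hp)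
  have hd : ∀ s ∈ Metric.ball p.2.2 r, HasDerivAt (fun s => F (p.1, p.2.1, s)) 0 s :=
    fun s hs => by
      have := hasDerivAt_vertical (differentiableAt_of_contDiffOn hF hΩ (hball hs))
      rwa [h0 _ (hball hs)] at this
  filter_upwards [Metric.ball_mem_nhds p.2.2 hr] with s hs
  exact Metric.isOpen_ball.is_const_of_fderiv_eq_zero (𝕜 := ℝ)
    (convex_ball _ _).isPreconnected
    (fun s hs => (hd s hs).differentiableAt.differentiableWithinAt)
    (fun s hs => by simp [(hd s hs).hasFDerivAt.fderiv]) hs (Metric.mem_ball_self hr)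

theorem partial_mul_u (hF : DifferentiableAt ℝ F p) :
    partialT (fun q => F q * q.2.2) p = partialT F p * p.2.2 ∧
    partialX (fun q => F q * q.2.2) p = partialX F p * p.2.2 := by
  have h2 : HasFDerivAt (fun q : Space => q.2.2)
      ((ContinuousLinearMap.snd ℝ ℝ ℝ).comp (ContinuousLinearMap.snd ℝ ℝ (ℝ × ℝ))) p :=
     (hasFDerivAt_snd (p := p)).snd
  have h := (hF.hasFDerivAt.fun_mul h2).fderiv
  simp only [partialT, partialX, h]
  simp [mul_comm]

end VerticalLines

/-! ### Determining equations and their solution -/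

section Classification

variable {Φ : Space → Space} {Ω : Set Space} {E E' : Equation} {p : Space}

/-- The Jacobian matrix is lower triangular with diagonal T_t, X_x, U_u. -/
theorem Separated.ne_zero (hΦ : Separated Φ Ω) (hd : (fderiv ℝ Φ p).det ≠ 0) (hp : p ∈ Ω) :
    partialT (fun p => (Φ p).1) p ≠ 0 ∧ partialX (fun p => (Φ p).2.1) p ≠ 0 ∧
      partialU (fun p => (Φ p).2.2) p ≠ 0 := by
  have hn : (∞ : WithTop ℕ∞) ≠ 0 := by simp
  have h := ((hΦ.smooth.contDiffAt (hΦ.isOpen.mem_nhds hp)).differentiableAt hn).hasFDerivAt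
  have hT : ∀ a b c, (fderiv ℝ Φ p (a, b, c)).1 = partialT (fun p => (Φ p).1) p * a := by
    intro a b c
    have : (fderiv ℝ Φ p (a, b, c)).1 = fderiv ℝ (fun p => (Φ p).1) p (a, b, c) := by
      rw [h.fst.fderiv]; rfl
    rw [this, clm_apply_space]
    have h1 := hΦ.fst_X p hp
    have h2 := hΦ.fst_U p hp
    simp only [partialX, partialU] at h1 h2
    simp [h1, h2, partialT, mul_comm]
  have hX : ∀ a b c, (fderiv ℝ Φ p (a, b, c)).2.1 = partialX (fun p => (Φ p).2.1) p * b := by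
    intro a b c
    have : (fderiv ℝ Φ p (a, b, c)).2.1 = fderiv ℝ (fun p => (Φ p).2.1) p (a, b, c) := by
      rw [h.snd.fst.fderiv]; rfl
    rw [this, clm_apply_space]
    have h1 := hΦ.snd_T p hp
    have h2 := hΦ.snd_U p hp
    simp only [partialT, partialU] at h1 h2
    simp [h1, h2, partialX, mul_comm]
  have hU : ∀ c, (fderiv ℝ Φ p (0, 0, c)).2.2 = partialU (fun p => (Φ p).2.2) p * c := by
    intro c
    have : (fderiv ℝ Φ p (0, 0, c)).2.2 = fderiv ℝ (fun p => (Φ p).2.2) p (0, 0, c) := by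
      rw [h.snd.snd.fderiv]; rfl
    rw [this, clm_apply_space]
    simp [partialU, mul_comm]
  obtain ⟨⟨a₁, b₁, c₁⟩, h₁⟩ := surjective_of_det_ne_zero hd (1, 0, 0)
  obtain ⟨⟨a₂, b₂, c₂⟩, h₂⟩ := surjective_of_det_ne_zero hd (0, 1, 0)
  obtain ⟨⟨a₃, b₃, c₃⟩, h₃⟩ := surjective_of_det_ne_zero hd (0, 0, 1)
  have t₁ := hT a₁ b₁ c₁
  have x₂ := hX a₂ b₂ c₂
  have t₃ := hT a₃ b₃ c₃
  have x₃ := hX a₃ b₃ c₃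
  rw [h₁] at t₁
  rw [h₂] at x₂
  rw [h₃] at t₃ x₃
  have nT : partialT (fun p => (Φ p).1) p ≠ 0 := fun h0 => by simp [h0] at t₁
  have nX : partialX (fun p => (Φ p).2.1) p ≠ 0 := fun h0 => by simp [h0] at x₂
  refine ⟨nT, nX, fun h0 => ?_⟩
  have ea : a₃ = 0 := by simpa [nT] using t₃.symm
  have eb : b₃ = 0 := by simpa [nX] using x₃.symm
  have u₃ := hU c₃
  rw [ea, eb] at h₃
  rw [h₃, h0] at u₃
  simp at u₃

/-- The condition on jets that a separated point transformation maps one equation of the class to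
another one. -/
theorem Separated.determining_identity (hΦ : Separated Φ Ω)
    (hd : (fderiv ℝ Φ p).det ≠ 0) (hmaps : MapsOn Φ Ω E E') (hp : p ∈ Ω) {U : Space → ℝ}
    (hU : U = fun p => (Φ p).2.2) {T₁ X₁ X₂ h' l' : ℝ}
    (hT₁ : T₁ = partialT (fun p => (Φ p).1) p)
    (hX₁ : X₁ = partialX (fun p => (Φ p).2.1) p)
    (hX₂ : X₂ = partialX (partialX fun p => (Φ p).2.1) p)
    (hh' : h' = E'.h (Φ p).1) (hl' : l' = E'.l (Φ p).1)
    (a b m n k : ℝ) (hk : a + p.2.2 * b + E.h p.1 * k = E.l p.1) :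
    (partialT U p + partialU U p * a) * X₁ ^ 3 +
      U p * (partialX U p + partialU U p * b) * T₁ * X₁ ^ 2 +
      h' * ((partialT (partialX (partialX U)) p + partialU (partialX (partialX U)) p * a +
      ((partialT (partialU (partialX U)) p + partialU (partialU (partialX U)) p * a) * b +
        partialU (partialX U) p * n) +
      (((partialT (partialX (partialU U)) p + partialU (partialX (partialU U)) p * a +
        ((partialT (partialU (partialU U)) p + partialU (partialU (partialU U)) p * a) * b +
          partialU (partialU U) p * n)) * b +
        (partialX (partialU U) p + partialU (partialU U) p * b) * n) +
      ((partialT (partialU U) p + partialU (partialU U) p * a) * m + partialU U p * k))) * X₁ -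
      X₂ * (partialT (partialX U) p + partialU (partialX U) p * a +
      ((partialT (partialU U) p + partialU (partialU U) p * a) * b + partialU U p * n))) =
    l' * T₁ * X₁ ^ 3 := by
  obtain ⟨t₀, x₀, w₀⟩ := p
  have hn : (∞ : WithTop ℕ∞) ≠ 0 := by simp
  set z : ℝ × ℝ := (t₀, x₀) with hz
  -- The derivatives u_tt, u_ttt, u_ttx and u_xxx do not enter the identity and are set to zero.
  let u := cubic z w₀ a b 0 n m 0 0 k 0
  have su : ContDiff ℝ ∞ u := contDiff_cubic ..
  have du := su.differentiable hn z
  have hg : graphPt u z = (t₀, x₀, w₀) := by simp [graphPt, u, hz]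
  have hΦp : ContDiffAt ℝ ∞ Φ (graphPt u z) :=
    hg ▸ hΦ.smooth.contDiffAt (hΦ.isOpen.mem_nhds hp)
  have hΦd := hΦp.differentiableAt hn
  have sU : ContDiffOn ℝ ∞ U Ω := hU ▸ hΦ.smooth.snd.snd
  have ne := hΦ.ne_zero hd hp
  have hdet : (fderiv ℝ (basePt Φ u) z).det ≠ 0 := by
    rw [det_plane, Dt_basePt hΦd du, Dx_basePt hΦd du,
      Dt_comp_graphPt (F := fun p => (Φ p).1) hΦd.fst du,
      Dt_comp_graphPt (F := fun p => (Φ p).2.1) hΦd.snd.fst du,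
      Dx_comp_graphPt (F := fun p => (Φ p).1) hΦd.fst du,
      Dx_comp_graphPt (F := fun p => (Φ p).2.1) hΦd.snd.fst du, hg,
      hΦ.fst_X _ hp, hΦ.fst_U _ hp, hΦ.snd_T _ hp, hΦ.snd_U _ hp]
    simpa using ⟨ne.1, ne.2.1⟩
  obtain ⟨v, hv⟩ := exists_carriesGerm hΦp su.contDiffAt hdet
  have hE : E.HoldsAt u z := by
    simp only [Equation.HoldsAt, u, Dt_cubic, Dx_cubic, cubic_self]
    exact hk
  have hE' := (hmaps.2 u v z (hg.symm ▸ hp) hv).1 hE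
  obtain ⟨v0, v1, v2, v3, v4⟩ := hΦ.jet (hg.symm ▸ hp) hv rfl (hg.symm ▸ hT₁) (hg.symm ▸ hX₁)
    (hg.symm ▸ hX₂)
  obtain ⟨j1, j2, j3, j4⟩ := jet_comp_graphPt sU hΦ.isOpen su hg hp (a := a) (b := b) (m := m)
    (n := n) (k := k) (by simp [u]) (by simp [u]) (by simp [u]) (by simp [u]) (by simp [u])
  have hY : (basePt Φ u z).1 = (Φ (t₀, x₀, w₀)).1 := by simp only [basePt, hg]
  simp only [Equation.HoldsAt] at hE'
  rw [hY, ← hh', ← hl'] at hE'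
  have w0 : U (t₀, x₀, w₀) = v (basePt Φ u z) := by rw [← v0, hg, hU]
  subst hU
  rw [j1] at v1
  rw [j2] at v2
  rw [j3] at v3
  rw [j4] at v4
  rw [v1, v2, v3, v4, w0]
  -- The factor T₁ X₁³ clears the denominators that arise when the derivatives of `v` are expressed
  -- through those of `u`.
  linear_combination T₁ * X₁ ^ 3 * hE'

/-- The determining equations for a point transformation between two equations of the class. -/
theorem Separated.determining_equations (hΦ : Separated Φ Ω)
    (hd : ∀ p ∈ Ω, (fderiv ℝ Φ p).det ≠ 0) (hmaps : MapsOn Φ Ω E E') {T X U : Space → ℝ}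
    (hT : T = fun p => (Φ p).1) (hX : X = fun p => (Φ p).2.1) (hU : U = fun p => (Φ p).2.2) :
    ∀ p ∈ Ω, partialT (partialU U) p = 0 ∧ partialU (partialU U) p = 0 ∧
      2 * partialX X p * partialX (partialU U) p = partialX (partialX X) p * partialU U p ∧
      U p * partialT T p * partialX X p * E.h p.1 = E'.h (T p) * p.2.2 ∧
      partialU U p * partialX X p ^ 3 + E'.h (T p) * (partialX X p *
        (partialU (partialX (partialX U)) p - partialU U p / E.h p.1) -
        partialX (partialX X) p * partialX (partialU U) p) = 0 ∧
      partialT U p * partialX X p ^ 3 + U p * partialX U p * partialT T p * partialX X p ^ 2 +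
        E'.h (T p) * (partialX X p *
          (partialT (partialX (partialX U)) p + partialU U p * (E.l p.1 / E.h p.1)) -
          partialX (partialX X) p * partialT (partialX U) p) =
        E'.l (T p) * partialT T p * partialX X p ^ 3 := by
  have hΩ := hΦ.isOpen
  have sU : ContDiffOn ℝ ∞ U Ω := hU ▸ hΦ.smooth.snd.snd
  have sUu := contDiffOn_partialU sU hΩ
  have key := fun p hp => hΦ.determining_identity (p := p) (hd p hp) hmaps hp hU rfl rfl rfl rfl rfl
  have hh := fun p hp => E.h_ne_zero _ (hmaps.1 p hp).1
  have hh' := fun p hp => E'.h_ne_zero _ (hmaps.1 p hp).2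
  have ne := fun p hp => hΦ.ne_zero (p := p) (hd p hp) hp
  -- The derivative u_xx occurs only in the product (U_tu + U_uu u_t) u_xx, so comparing m = 1 with
  -- m = 0 isolates that factor for every u_t.
  have second : ∀ p ∈ Ω, partialT (partialU U) p = 0 ∧ partialU (partialU U) p = 0 := by
    intro p hp
    have k0 : ∀ a : ℝ, a + p.2.2 * 0 + E.h p.1 * ((E.l p.1 - a) / E.h p.1) = E.l p.1 :=
      fun a => by rw [mul_div_cancel₀ _ (hh p hp)]; ring
    have e : ∀ a : ℝ, partialT (partialU U) p + partialU (partialU U) p * a = 0 := by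
      intro a
      have e1 := key p hp a 0 1 0 _ (k0 a)
      have e0 := key p hp a 0 0 0 _ (k0 a)
      have : E'.h (Φ p).1 * partialX (fun p => (Φ p).2.1) p *
          (partialT (partialU U) p + partialU (partialU U) p * a) = 0 := by
        linear_combination e1 - e0
      exact (mul_eq_zero.1 this).resolve_left (mul_ne_zero (hh' p hp) (ne p hp).2.1)
    have e0 := e 0
    have e1 := e 1
    constructor <;> linarith
  intro p hp
  obtain ⟨h1, h2⟩ := second p hp
  have eUX : EqOn (partialU (partialX U)) (partialX (partialU U)) Ω :=
    fun q hq => partialU_partialX_comm sU hΩ hq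
  have f1 : partialU (partialX U) p = partialX (partialU U) p := eUX hp
  have z1 := partial_eq_zero_of_eqOn_zero hΩ (fun q hq => (second q hq).1) hp
  have z2 := partial_eq_zero_of_eqOn_zero hΩ (fun q hq => (second q hq).2) hp
  have g1 : partialT (partialX (partialU U)) p = 0 := by
    rw [partialT_partialX_comm sUu hΩ hp, z1.2.1]
  have g2 : partialU (partialX (partialU U)) p = 0 := by
    rw [partialU_partialX_comm sUu hΩ hp, z2.2.1]
  have f2 : partialT (partialU (partialX U)) p = 0 :=
    (congrArg (fun L : Space →L[ℝ] ℝ => L (1, 0, 0)) (fderiv_eq_of_eqOn hΩ eUX hp)).trans g1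
  have f3 : partialU (partialU (partialX U)) p = 0 :=
    (congrArg (fun L : Space →L[ℝ] ℝ => L (0, 0, 1)) (fderiv_eq_of_eqOn hΩ eUX hp)).trans g2
  have K := key p hp
  rw [h1, h2, f1, f2, f3, g1, g2, z2.1, z2.2.2] at K
  have X1 := (ne p hp).2.1
  have U1 := (ne p hp).2.2
  have H := hh p hp
  have H' := hh' p hp
  subst hT hX
  rw [← hU] at U1
  simp only at K ⊢
  -- With k eliminated and U_tu = U_uu = 0, the identity is affine in u_t, u_x, u_tx and free of
  -- u_xx. Its coefficients are differences of its values at 1 and 0.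
  have k0 : ∀ a b : ℝ, a + p.2.2 * b + E.h p.1 * ((E.l p.1 - a - p.2.2 * b) / E.h p.1) =
    E.l p.1 := fun a b => by rw [mul_div_cancel₀ _ H]; ring
  have K0 := K 0 0 0 0 _ (k0 0 0)
  have Kn := K 0 0 0 1 _ (k0 0 0)
  have Ka := K 1 0 0 0 _ (k0 1 0)
  have Kb := K 0 1 0 0 _ (k0 0 1)
  refine ⟨h1, h2, ?_, ?_, ?_, ?_⟩
  · refine mul_left_cancel₀ H' ?_
    linear_combination Kn - K0
  · refine mul_left_cancel₀ (mul_ne_zero U1 X1) ?_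
    have e : partialU U p * (partialX (fun p => (Φ p).2.1) p *
        (U p * partialT (fun p => (Φ p).1) p * partialX (fun p => (Φ p).2.1) p -
        E'.h (Φ p).1 * (p.2.2 / E.h p.1))) = 0 := by
      linear_combination Kb - K0
    field_simp at e
    linear_combination e
  · linear_combination Ka - K0
  · linear_combination K0

/-- The last two conclusions read δ₁ and δ₃ off the map alone, which later shows that they do not
depend on the equation used. -/
theorem exists_parameters (hΩ : IsOpen Ω) (hconn : IsConnected Ω) (hs : ContDiffOn ℝ ∞ Φ Ω)
    (hd : ∀ p ∈ Ω, (fderiv ℝ Φ p).det ≠ 0) (hmaps : MapsOn Φ Ω E E') :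
    ∃ δ₀ δ₁ δ₂ δ₃ : ℝ, δ₁ * δ₃ ≠ 0 ∧ ∀ p ∈ Ω,
      Φ p = (δ₁ / δ₃ * p.1 + δ₀, δ₁ * p.2.1 + δ₂, δ₃ * p.2.2) ∧
      E'.h (Φ p).1 = δ₁ ^ 2 * E.h p.1 ∧ E'.l (Φ p).1 = δ₃ ^ 2 / δ₁ * E.l p.1 ∧
      partialX (fun p => (Φ p).2.1) p = δ₁ ∧ partialU (fun p => (Φ p).2.2) p = δ₃ := by
  have hpz := fun p hp => partial_eq_zero (hs.contDiffAt (hΩ.mem_nhds hp)) (hd p hp) hmaps hp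
  have hΦ : Separated Φ Ω := ⟨hΩ, hs, fun p hp => (hpz p hp).1, fun p hp => (hpz p hp).2.1,
    fun p hp => (hpz p hp).2.2.1, fun p hp => (hpz p hp).2.2.2⟩
  set T : Space → ℝ := fun p => (Φ p).1 with hT
  set X : Space → ℝ := fun p => (Φ p).2.1 with hX
  set U : Space → ℝ := fun p => (Φ p).2.2 with hU
  have sT : ContDiffOn ℝ ∞ T Ω := hs.fst
  have sX : ContDiffOn ℝ ∞ X Ω := hs.snd.fst
  have sU : ContDiffOn ℝ ∞ U Ω := hs.snd.snd
  have sT' := contDiffOn_partialT sT hΩ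
  have sX' := contDiffOn_partialX sX hΩ
  have sg := contDiffOn_partialU sU hΩ
  have sgx := contDiffOn_partialX sg hΩ
  have det := hΦ.determining_equations hd hmaps hT hX hU
  have hh := fun p hp => E.h_ne_zero _ (hmaps.1 p hp).1
  have ne := fun p hp => hΦ.ne_zero (p := p) (hd p hp) hp
  have T'u : ∀ p ∈ Ω, partialU (partialT T) p = 0 := fun p hp => by
    rw [← partialT_partialU_comm sT hΩ hp]
    exact (partial_eq_zero_of_eqOn_zero hΩ hΦ.fst_U hp).1
  have X'u : ∀ p ∈ Ω, partialU (partialX X) p = 0 := fun p hp => by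
    rw [partialU_partialX_comm sX hΩ hp]
    exact (partial_eq_zero_of_eqOn_zero hΩ hΦ.snd_U hp).2.1
  have X't : ∀ p ∈ Ω, partialT (partialX X) p = 0 := fun p hp => by
    rw [partialT_partialX_comm sX hΩ hp]
    exact (partial_eq_zero_of_eqOn_zero hΩ hΦ.snd_T hp).2.1
  have vT := fun p hp => eventually_vertical_eq (p := p) sT hΩ hΦ.fst_U hp
  have vT' := fun p hp => eventually_vertical_eq (p := p) sT' hΩ T'u hp
  have vX' := fun p hp => eventually_vertical_eq (p := p) sX' hΩ X'u hp
  have vg := fun p hp => eventually_vertical_eq (p := p) sg hΩ (fun p hp => (det p hp).2.1) hp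
  have gxu : ∀ p ∈ Ω, partialU (partialX (partialU U)) p = 0 := fun p hp => by
    rw [partialU_partialX_comm sg hΩ hp]
    exact (partial_eq_zero_of_eqOn_zero hΩ (fun p hp => (det p hp).2.1) hp).2.1
  have vgx := fun p hp => eventually_vertical_eq (p := p) sgx hΩ gxu hp
  -- In U T_t X_x h = h' u, all factors except U and u are locally constant on the vertical line, so
  -- U is there a multiple of u and U_u is the quotient.
  have hκ : ∀ p ∈ Ω, partialU U p =
      E'.h (T p) / (partialT T p * partialX X p * E.h p.1) := by
    intro p hp
    refine (hasDerivAt_vertical (differentiableAt_of_contDiffOn sU hΩ hp)).unique ?_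
    have h1 : HasDerivAt (fun s : ℝ => E'.h (T p) / (partialT T p * partialX X p * E.h p.1) * s)
        (E'.h (T p) / (partialT T p * partialX X p * E.h p.1)) p.2.2 := by
      simpa using (hasDerivAt_id p.2.2).const_mul
        (E'.h (T p) / (partialT T p * partialX X p * E.h p.1))
    refine h1.congr_of_eventuallyEq ?_
    filter_upwards [eventually_vertical_mem hΩ hp, vT p hp, vT' p hp, vX' p hp] with s m1 m2 m3 m4
    have := (det _ m1).2.2.2.1
    rw [m2, m3, m4] at this
    have n1 := (ne p hp).1
    have n2 := (ne p hp).2.1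
    have n3 := hh p hp
    rw [div_mul_eq_mul_div, eq_div_iff (mul_ne_zero (mul_ne_zero n1 n2) n3)]
    simp only at this
    linear_combination this
  have hUg : EqOn U (fun p => partialU U p * p.2.2) Ω := fun p hp => by
    have n1 := (ne p hp).1
    have n2 := (ne p hp).2.1
    have n3 := hh p hp
    have := (det p hp).2.2.2.1
    simp only
    rw [hκ p hp, div_mul_eq_mul_div, eq_div_iff (mul_ne_zero (mul_ne_zero n1 n2) n3)]
    linear_combination this
  have dg := fun p hp => differentiableAt_of_contDiffOn (p := p) sg hΩ hp
  have Ut : ∀ p ∈ Ω, partialT U p = 0 := fun p hp => by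
    rw [partialT, fderiv_eq_of_eqOn hΩ hUg hp]
    refine (partial_mul_u (dg p hp)).1.trans ?_
    rw [(det p hp).1, zero_mul]
  have Ux : EqOn (partialX U) (fun p => partialX (partialU U) p * p.2.2) Ω := fun p hp => by
    rw [partialX, fderiv_eq_of_eqOn hΩ hUg hp]
    exact (partial_mul_u (dg p hp)).2
  have Uxt : ∀ p ∈ Ω, partialT (partialX U) p = 0 := fun p hp => by
    rw [partialT_partialX_comm sU hΩ hp]
    exact (partial_eq_zero_of_eqOn_zero hΩ Ut hp).2.1
  have Uxxt : ∀ p ∈ Ω, partialT (partialX (partialX U)) p = 0 := fun p hp => by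
    rw [partialT_partialX_comm (contDiffOn_partialX sU hΩ) hΩ hp]
    exact (partial_eq_zero_of_eqOn_zero hΩ Uxt hp).2.1
  have const : ∀ p ∈ Ω, partialU U p * partialX (partialU U) p * partialT T p *
      partialX X p ^ 2 * p.2.2 ^ 2 +
      E'.h (T p) * (partialX X p * (partialU U p * (E.l p.1 / E.h p.1))) =
        E'.l (T p) * partialT T p * partialX X p ^ 3 := by
    intro p hp
    have := (det p hp).2.2.2.2.2
    rw [Ut p hp, Uxt p hp, Uxxt p hp, Ux hp, hUg hp] at this
    linear_combination this
  -- In `const` only the u² term varies along a vertical line. The second difference of s² with step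
  -- r/2 is r²/2, hence the factor 2 in the combination below.
  have gx : ∀ p ∈ Ω, partialX (partialU U) p = 0 := by
    intro p hp
    have ev : ∀ᶠ s in 𝓝 p.2.2, partialU U p * partialX (partialU U) p * partialT T p *
        partialX X p ^ 2 * s ^ 2 +
        E'.h (T p) * (partialX X p * (partialU U p * (E.l p.1 / E.h p.1))) =
        E'.l (T p) * partialT T p * partialX X p ^ 3 := by
      filter_upwards [eventually_vertical_mem hΩ hp, vT p hp, vT' p hp, vX' p hp, vg p hp,
        vgx p hp] with s m1 m2 m3 m4 m5 m6
      have := const _ m1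
      rwa [m2, m3, m4, m5, m6] at this
    obtain ⟨r, hr, hball⟩ := Metric.mem_nhds_iff.1 ev
    have c0 := const p hp
    have c1 := hball (show p.2.2 + r / 2 ∈ Metric.ball p.2.2 r by
      rw [Metric.mem_ball, Real.dist_eq, add_sub_cancel_left, abs_of_pos (by positivity)]
      linarith)
    have c2 := hball (show p.2.2 - r / 2 ∈ Metric.ball p.2.2 r by
      rw [Metric.mem_ball, Real.dist_eq, sub_sub_cancel_left, abs_neg,
        abs_of_pos (by positivity)]
      linarith)
    simp only [mem_ofPred_eq] at c1 c2
    have : (partialU U p * partialT T p * partialX X p ^ 2 * r ^ 2) *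
        partialX (partialU U) p = 0 := by
      linear_combination 2 * (c1 + c2 - 2 * c0)
    refine (mul_eq_zero.1 this).resolve_left ?_
    exact mul_ne_zero (mul_ne_zero (mul_ne_zero (ne p hp).2.2 (ne p hp).1)
      (pow_ne_zero _ (ne p hp).2.1)) (pow_ne_zero _ hr.ne')
  have X'x : ∀ p ∈ Ω, partialX (partialX X) p = 0 := fun p hp => by
    have := (det p hp).2.2.1
    rw [gx p hp, mul_zero] at this
    exact (mul_eq_zero.1 this.symm).resolve_right (ne p hp).2.2
  have Ux0 : ∀ p ∈ Ω, partialX U p = 0 := fun p hp => by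
    rw [Ux hp]; simp only [gx p hp, zero_mul]
  have Uxxu : ∀ p ∈ Ω, partialU (partialX (partialX U)) p = 0 := fun p hp =>
    (partial_eq_zero_of_eqOn_zero hΩ
      (fun q hq => (partial_eq_zero_of_eqOn_zero hΩ Ux0 hq).2.1) hp).2.2
  -- This is the coefficient of u_t, reduced by X_xx = 0 and U_xxu = 0.
  have hX2 : ∀ p ∈ Ω, E'.h (T p) = partialX X p ^ 2 * E.h p.1 := fun p hp => by
    have := (det p hp).2.2.2.2.1
    rw [Uxxu p hp, X'x p hp] at this
    have n2 := (ne p hp).2.1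
    have n3 := hh p hp
    have n4 := (ne p hp).2.2
    have e : partialX X p * partialU U p *
        (partialX X p ^ 2 - E'.h (T p) / E.h p.1) = 0 := by
      linear_combination this
    have e2 := (mul_eq_zero.1 e).resolve_left (mul_ne_zero n2 n4)
    field_simp at e2
    linear_combination -e2
  have hTg : ∀ p ∈ Ω, partialT T p = partialX X p / partialU U p := fun p hp => by
    have := hκ p hp
    have n1 := (ne p hp).1
    have n2 := (ne p hp).2.1
    have n3 := hh p hp
    have n4 := (ne p hp).2.2
    rw [eq_div_iff (mul_ne_zero (mul_ne_zero n1 n2) n3), hX2 p hp] at this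
    rw [eq_div_iff n4]
    refine mul_left_cancel₀ (mul_ne_zero n2 n3) ?_
    linear_combination this
  have hl : ∀ p ∈ Ω, E'.l (T p) = partialU U p ^ 2 / partialX X p * E.l p.1 := fun p hp => by
    have := const p hp
    have n1 := (ne p hp).1
    have n2 := (ne p hp).2.1
    have n3 := hh p hp
    have n4 := (ne p hp).2.2
    rw [gx p hp, hX2 p hp, hTg p hp] at this
    have n4' : partialU U p ≠ 0 := n4
    have n2' : partialX X p ≠ 0 := n2
    have e : partialX X p ^ 3 * partialU U p * E.l p.1 =
        E'.l (T p) * (partialX X p / partialU U p) * partialX X p ^ 3 := by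
      rw [← this]
      field_simp
      ring
    rw [div_mul_eq_mul_div, eq_div_iff n2']
    field_simp at e
    linear_combination -e
  -- X_x and U_u have zero differential, so connectedness of Ω makes them global constants; the same
  -- argument then gives the translation parts of T and X.
  obtain ⟨δ₁, hδ₁⟩ := hΩ.exists_is_const_of_fderiv_eq_zero (𝕜 := ℝ) hconn.isPreconnected
    (fun p hp => (differentiableAt_of_contDiffOn sX' hΩ hp).differentiableWithinAt)
    (fun p hp => fderiv_eq_zero_of_partial (X't p hp) (X'x p hp) (X'u p hp))
  obtain ⟨δ₃, hδ₃⟩ := hΩ.exists_is_const_of_fderiv_eq_zero (𝕜 := ℝ) hconn.isPreconnected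
    (fun p hp => (dg p hp).differentiableWithinAt)
    (fun p hp => fderiv_eq_zero_of_partial (det p hp).1 (gx p hp) (det p hp).2.1)
  have dT := fun p hp => differentiableAt_of_contDiffOn (p := p) sT hΩ hp
  have dX := fun p hp => differentiableAt_of_contDiffOn (p := p) sX hΩ hp
  have fT : ∀ p : Space, HasFDerivAt (fun p : Space => δ₁ / δ₃ * p.1)
      ((δ₁ / δ₃) • ContinuousLinearMap.fst ℝ ℝ (ℝ × ℝ)) p := fun p =>
    (hasFDerivAt_fst (p := p)).const_mul (δ₁ / δ₃)
  have fX : ∀ p : Space, HasFDerivAt (fun p : Space => δ₁ * p.2.1)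
      (δ₁ • (ContinuousLinearMap.fst ℝ ℝ ℝ).comp (ContinuousLinearMap.snd ℝ ℝ (ℝ × ℝ))) p :=
    fun p =>
    (hasFDerivAt_snd (p := p)).fst.const_mul δ₁
  obtain ⟨δ₀, hδ₀⟩ := hΩ.exists_is_const_of_fderiv_eq_zero (𝕜 := ℝ) hconn.isPreconnected
    (f := fun p => T p - δ₁ / δ₃ * p.1)
    (fun p hp => ((dT p hp).fun_sub (fT p).differentiableAt).differentiableWithinAt)
    (fun p hp => by
      have e := ((dT p hp).hasFDerivAt.fun_sub (fT p)).fderiv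
      have h1 := hTg p hp
      rw [hδ₁ p hp, hδ₃ p hp] at h1
      have h2 : partialX T p = 0 := hΦ.fst_X p hp
      have h3 : partialU T p = 0 := hΦ.fst_U p hp
      simp only [partialT, partialX, partialU] at h1 h2 h3
      refine fderiv_eq_zero_of_partial ?_ ?_ ?_ <;> simp only [partialT, partialX, partialU, e]
      · simp [h1]
      · simp [h2]
      · simp [h3])
  obtain ⟨δ₂, hδ₂⟩ := hΩ.exists_is_const_of_fderiv_eq_zero (𝕜 := ℝ) hconn.isPreconnected
    (f := fun p => X p - δ₁ * p.2.1)
    (fun p hp => ((dX p hp).fun_sub (fX p).differentiableAt).differentiableWithinAt)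
    (fun p hp => by
      have e := ((dX p hp).hasFDerivAt.fun_sub (fX p)).fderiv
      have h1 := hδ₁ p hp
      have h2 : partialT X p = 0 := hΦ.snd_T p hp
      have h3 : partialU X p = 0 := hΦ.snd_U p hp
      simp only [partialT, partialX, partialU] at h1 h2 h3
      refine fderiv_eq_zero_of_partial ?_ ?_ ?_ <;> simp only [partialT, partialX, partialU, e]
      · simp [h2]
      · simp [h1]
      · simp [h3])
  obtain ⟨p₀, hp₀⟩ := hconn.nonempty
  refine ⟨δ₀, δ₁, δ₂, δ₃, ?_, fun p hp => ⟨?_, ?_, ?_, hδ₁ p hp, hδ₃ p hp⟩⟩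
  · rw [← hδ₁ p₀ hp₀, ← hδ₃ p₀ hp₀]
    exact mul_ne_zero (ne p₀ hp₀).2.1 (ne p₀ hp₀).2.2
  · refine Prod.ext ?_ (Prod.ext ?_ ?_)
    · have := hδ₀ p hp
      simp only [hT] at this ⊢
      linear_combination this
    · have := hδ₂ p hp
      simp only [hX] at this ⊢
      linear_combination this
    · have := hUg hp
      simp only [hδ₃ p hp] at this
      exact this
  · rw [← hδ₁ p hp]; exact hX2 p hp
  · rw [← hδ₁ p hp, ← hδ₃ p hp]; exact hl p hp

end Classification

/-! ### Scalings and translations preserve the class -/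

/-- The scalings and translations which form the equivalence group. -/
noncomputable def scaling (δ₀ δ₁ δ₂ δ₃ : ℝ) : Space → Space :=
  fun p => (δ₁ / δ₃ * p.1 + δ₀, δ₁ * p.2.1 + δ₂, δ₃ * p.2.2)

section Scaling

variable {δ₀ δ₁ δ₂ δ₃ : ℝ}

theorem contDiff_scaling : ContDiff ℝ ∞ (scaling δ₀ δ₁ δ₂ δ₃) := by
  unfold scaling
  fun_prop

theorem fderiv_scaling (p d : Space) :
    fderiv ℝ (scaling δ₀ δ₁ δ₂ δ₃) p d = (δ₁ / δ₃ * d.1, δ₁ * d.2.1, δ₃ * d.2.2) := by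
  have hf : HasFDerivAt (scaling δ₀ δ₁ δ₂ δ₃)
      (((δ₁ / δ₃) • ContinuousLinearMap.fst ℝ ℝ (ℝ × ℝ)).prod
        ((δ₁ • (ContinuousLinearMap.fst ℝ ℝ ℝ).comp (ContinuousLinearMap.snd ℝ ℝ (ℝ × ℝ))).prod
          (δ₃ • (ContinuousLinearMap.snd ℝ ℝ ℝ).comp
            (ContinuousLinearMap.snd ℝ ℝ (ℝ × ℝ))))) p :=
    ((hasFDerivAt_fst.const_mul _).add_const _).prodMk
      (((hasFDerivAt_snd.fst.const_mul _).add_const _).prodMk (hasFDerivAt_snd.snd.const_mul _))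
  rw [hf.fderiv]
  simp

theorem det_ne_zero_of_injective {V : Type*} [NormedAddCommGroup V] [NormedSpace ℝ V]
    [FiniteDimensional ℝ V] {L : V →L[ℝ] V} (h : ∀ d, L d = 0 → d = 0) : L.det ≠ 0 := by
  have hk : LinearMap.ker (L : V →ₗ[ℝ] V) = ⊥ := LinearMap.ker_eq_bot'.2 h
  have hu : IsUnit (L : V →ₗ[ℝ] V) := LinearMap.isUnit_iff_ker_eq_bot _ |>.2 hk
  exact ((LinearMap.isUnit_iff_isUnit_det _).1 hu).ne_zero

/-- The image of an equation of the class under a scaling. -/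
noncomputable def Equation.scale (E : Equation) (δ₀ : ℝ) {δ₁ δ₃ : ℝ} (hδ : δ₁ * δ₃ ≠ 0) :
    Equation where
  I := (fun s => δ₃ / δ₁ * (s - δ₀)) ⁻¹' E.I
  isOpen_I := E.isOpen_I.preimage (by fun_prop)
  ordConnected_I := by
    -- The signs of the parameters are free, so the change of time may reverse the order.
    rcases le_total 0 (δ₃ / δ₁) with h | h
    · exact E.ordConnected_I.preimage_mono fun a b hab => by
        have := sub_le_sub_right hab δ₀
        exact mul_le_mul_of_nonneg_left this h
    · exact E.ordConnected_I.preimage_anti fun a b hab => by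
        have := sub_le_sub_right hab δ₀
        exact mul_le_mul_of_nonpos_left this h
  nonempty_I := by
    obtain ⟨t, ht⟩ := E.nonempty_I
    refine ⟨δ₁ / δ₃ * t + δ₀, ?_⟩
    have h1 := left_ne_zero_of_mul hδ
    have h3 := right_ne_zero_of_mul hδ
    have : δ₃ / δ₁ * (δ₁ / δ₃ * t + δ₀ - δ₀) = t := by field_simp; ring
    simpa only [mem_preimage, this] using ht
  h := fun s => δ₁ ^ 2 * E.h (δ₃ / δ₁ * (s - δ₀))
  l := fun s => δ₃ ^ 2 / δ₁ * E.l (δ₃ / δ₁ * (s - δ₀))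
  smooth_h := contDiffOn_const.mul (E.smooth_h.comp
    (ContDiff.contDiffOn (by fun_prop)) fun _ hs => hs)
  smooth_l := contDiffOn_const.mul (E.smooth_l.comp
    (ContDiff.contDiffOn (by fun_prop)) fun _ hs => hs)
  h_ne_zero := fun s hs =>
    mul_ne_zero (pow_ne_zero _ (left_ne_zero_of_mul hδ)) (E.h_ne_zero _ hs)

theorem scale_arg (hδ : δ₁ * δ₃ ≠ 0) (t : ℝ) : δ₃ / δ₁ * (δ₁ / δ₃ * t + δ₀ - δ₀) = t := by
  have h1 := left_ne_zero_of_mul hδ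
  have h3 := right_ne_zero_of_mul hδ
  field_simp
  ring

variable {Φ : Space → Space} {Ω : Set Space}

/-- Each term of the equation acquires the same nonzero factor δ₃²/δ₁. -/
theorem mapsOn_scale (hΩ : IsOpen Ω) (hδ : δ₁ * δ₃ ≠ 0)
    (hΦ : EqOn Φ (scaling δ₀ δ₁ δ₂ δ₃) Ω) (E : Equation) :
    MapsOn Φ {p ∈ Ω | p.1 ∈ E.I} E (E.scale δ₀ hδ) := by
  have h1 := left_ne_zero_of_mul hδ
  have h3 := right_ne_zero_of_mul hδ
  have hn : (∞ : WithTop ℕ∞) ≠ 0 := by simp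
  have hsc : ∀ p, HasFDerivAt (scaling δ₀ δ₁ δ₂ δ₃) (fderiv ℝ (scaling δ₀ δ₁ δ₂ δ₃) p) p :=
    fun p => (contDiff_scaling.differentiable hn p).hasFDerivAt
  have fT : ∀ p ∈ Ω, ∀ d, fderiv ℝ (fun p => (Φ p).1) p d = δ₁ / δ₃ * d.1 := fun p hp d => by
    rw [fderiv_eq_of_eqOn (G := fun p => (scaling δ₀ δ₁ δ₂ δ₃ p).1) hΩ
      (fun q hq => by simp only [hΦ hq]) hp, (hsc p).fst.fderiv]
    simp [fderiv_scaling]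
  have fX : ∀ p ∈ Ω, ∀ d, fderiv ℝ (fun p => (Φ p).2.1) p d = δ₁ * d.2.1 := fun p hp d => by
    rw [fderiv_eq_of_eqOn (G := fun p => (scaling δ₀ δ₁ δ₂ δ₃ p).2.1) hΩ
      (fun q hq => by simp only [hΦ hq]) hp, (hsc p).snd.fst.fderiv]
    simp [fderiv_scaling]
  have sep : Separated Φ Ω := by
    refine ⟨hΩ, contDiff_scaling.contDiffOn.congr hΦ, fun p hp => ?_, fun p hp => ?_,
      fun p hp => ?_, fun p hp => ?_⟩
    · simp [partialX, fT p hp]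
    · simp [partialU, fT p hp]
    · simp [partialT, fX p hp]
    · simp [partialU, fX p hp]
  refine ⟨fun p hp => ⟨hp.2, ?_⟩, fun u v z hz hv => ?_⟩
  · rw [hΦ hp.1]
    simp only [scaling, Equation.scale, mem_preimage, scale_arg hδ]
    exact hp.2
  have hzΩ := hz.1
  have T₁ : δ₁ / δ₃ = partialT (fun p => (Φ p).1) (graphPt u z) := by
    simp [partialT, fT _ hzΩ]
  have X₁ : ∀ p ∈ Ω, partialX (fun p => (Φ p).2.1) p = δ₁ := fun p hp => by
    simp [partialX, fX p hp]
  have X₂ : 0 = partialX (partialX fun p => (Φ p).2.1) (graphPt u z) := by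
    rw [partialX, fderiv_eq_of_eqOn (G := fun _ => δ₁) hΩ X₁ hzΩ]
    simp
  obtain ⟨v0, v1, v2, -, v4⟩ := sep.jet hzΩ hv rfl T₁ (X₁ _ hzΩ).symm X₂
  have three : (3 : WithTop ℕ∞) ≤ ∞ := WithTop.coe_le_coe.2 (le_top : (3 : ℕ∞) ≤ ⊤)
  have hu := hv.1
  obtain ⟨W, hWs, hW, hzW⟩ := mem_nhds_iff.1 (((hu.of_le three).eventually (by decide)).and
    ((contDiffAt_graphPt hu).continuousAt.eventually_mem (hΩ.mem_nhds hzΩ)))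
  have c0 : ContDiffOn ℝ 3 u W := fun y hy => ContDiffAt.contDiffWithinAt (hWs hy).1
  have c1 : ContDiffOn ℝ 2 (Dx u) W := contDiffOn_Dx c0 hW (by norm_num)
  have c2 : ContDiffOn ℝ 1 (Dx (Dx u)) W := contDiffOn_Dx c1 hW (by norm_num)
  have dif : ∀ {f : ℝ × ℝ → ℝ}, ContDiffOn ℝ 1 f W → ∀ y ∈ W, DifferentiableAt ℝ f y :=
    fun hf y hy => (hf.contDiffAt (hW.mem_nhds hy)).differentiableAt (by norm_num)
  have d0 := dif (c0.of_le (by norm_num))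
  have d1 := dif (c1.of_le (by norm_num))
  have e0 : EqOn (fun y => (Φ (graphPt u y)).2.2) (fun y => δ₃ * u y) W := fun y hy => by
    simp only [hΦ (hWs hy).2]; rfl
  have e1 : EqOn (Dx fun y => (Φ (graphPt u y)).2.2) (fun y => δ₃ * Dx u y) W := fun y hy => by
    rw [eqOn_Dx hW e0 hy, Dx_const_mul _ (d0 y hy)]
  have e2 : EqOn (Dx (Dx fun y => (Φ (graphPt u y)).2.2)) (fun y => δ₃ * Dx (Dx u) y) W :=
    fun y hy => by rw [eqOn_Dx hW e1 hy, Dx_const_mul _ (d1 y hy)]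
  rw [eqOn_Dt hW e2 hzW, Dt_const_mul _ (dif c2 z hzW)] at v4
  rw [e1 hzW] at v2
  rw [eqOn_Dt hW e0 hzW, Dt_const_mul _ (d0 z hzW)] at v1
  simp only at v2
  rw [show (Φ (graphPt u z)).2.2 = δ₃ * u z from e0 hzW] at v0
  have hY : (basePt Φ u z).1 = δ₁ / δ₃ * z.1 + δ₀ := by
    simp only [basePt, hΦ hzΩ]; rfl
  have w1 : Dt v (basePt Φ u z) = δ₃ ^ 2 / δ₁ * Dt u z := by
    field_simp
    field_simp at v1
    linear_combination -v1
  have w2 : Dx v (basePt Φ u z) = δ₃ / δ₁ * Dx u z := by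
    field_simp
    linear_combination -v2
  have w4 : δ₁ ^ 2 * Dt (Dx (Dx v)) (basePt Φ u z) = δ₃ ^ 2 / δ₁ * Dt (Dx (Dx u)) z := by
    field_simp
    field_simp at v4
    linear_combination -v4
  simp only [Equation.HoldsAt, Equation.scale, hY, scale_arg hδ]
  rw [w1, w2, ← v0, mul_right_comm (δ₁ ^ 2), w4]
  have hc : δ₃ ^ 2 / δ₁ ≠ 0 := div_ne_zero (pow_ne_zero _ h3) h1
  have expand : δ₃ ^ 2 / δ₁ * Dt u z + δ₃ * u z * (δ₃ / δ₁ * Dx u z) +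
      δ₃ ^ 2 / δ₁ * Dt (Dx (Dx u)) z * E.h z.1 =
      δ₃ ^ 2 / δ₁ * (Dt u z + u z * Dx u z + E.h z.1 * Dt (Dx (Dx u)) z) := by ring
  rw [expand]
  exact (mul_right_inj' hc).symm

theorem JointTransformation.isUsualEquivalence_of_scaling (A : JointTransformation)
    (hδ : δ₁ * δ₃ ≠ 0)
    (hA : ∀ t x u : ℝ, (t, x, u) ∈ A.pt.dom →
      A.pt.toFun (t, x, u) = (δ₁ / δ₃ * t + δ₀, δ₁ * x + δ₂, δ₃ * u) ∧
      ∀ h l : ℝ, h ≠ 0 → A.elems ((t, x, u), (h, l)) = (δ₁ ^ 2 * h, δ₃ ^ 2 / δ₁ * l)) :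
    A.IsUsualEquivalence := fun E => by
  refine ⟨E.scale δ₀ hδ, mapsOn_scale (δ₂ := δ₂) A.pt.isOpen_dom hδ
    (fun p hp => (hA p.1 p.2.1 p.2.2 hp).1) E, fun p hp => ?_⟩
  obtain ⟨e1, e2⟩ := hA p.1 p.2.1 p.2.2 hp.1
  rw [e2 _ _ (E.h_ne_zero _ hp.2), e1]
  simp only [Equation.scale, scale_arg hδ]

/-! ### The equivalence group and normalization -/

/-- The equation of the class with constant arbitrary elements. -/
def Equation.const (h l : ℝ) (hh : h ≠ 0) : Equation where
  I := univ
  isOpen_I := isOpen_univ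
  ordConnected_I := ordConnected_univ
  nonempty_I := univ_nonempty
  h := fun _ => h
  l := fun _ => l
  smooth_h := contDiffOn_const
  smooth_l := contDiffOn_const
  h_ne_zero := fun _ _ => hh

/-- Constant equations live over all of ℝ, so each one constrains the map on its whole domain, and
together they realize every pair of values of the arbitrary elements. -/
theorem JointTransformation.IsUsualEquivalence.exists_parameters {A : JointTransformation}
    (hA : A.IsUsualEquivalence) : ∃ δ₀ δ₁ δ₂ δ₃ : ℝ, δ₁ * δ₃ ≠ 0 ∧
      ∀ t x u : ℝ, (t, x, u) ∈ A.pt.dom →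
        A.pt.toFun (t, x, u) = (δ₁ / δ₃ * t + δ₀, δ₁ * x + δ₂, δ₃ * u) ∧
        ∀ h l : ℝ, h ≠ 0 →
          A.elems ((t, x, u), (h, l)) = (δ₁ ^ 2 * h, δ₃ ^ 2 / δ₁ * l) := by
  have key : ∀ (h l : ℝ) (hh : h ≠ 0), ∃ δ₀ δ₁ δ₂ δ₃ : ℝ, δ₁ * δ₃ ≠ 0 ∧ ∀ p ∈ A.pt.dom,
      A.pt.toFun p = (δ₁ / δ₃ * p.1 + δ₀, δ₁ * p.2.1 + δ₂, δ₃ * p.2.2) ∧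
      A.elems (p, (h, l)) = (δ₁ ^ 2 * h, δ₃ ^ 2 / δ₁ * l) ∧
      partialX (fun p => (A.pt.toFun p).2.1) p = δ₁ ∧
      partialU (fun p => (A.pt.toFun p).2.2) p = δ₃ := by
    intro h l hh
    obtain ⟨E', hmaps, hel⟩ := hA (Equation.const h l hh)
    have hS : {p ∈ A.pt.dom | p.1 ∈ (Equation.const h l hh).I} = A.pt.dom := by
      ext p; simp [Equation.const]
    rw [hS] at hmaps hel
    obtain ⟨δ₀, δ₁, δ₂, δ₃, hδ, hp⟩ := BBM.exists_parameters A.pt.isOpen_dom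
      A.pt.isConnected_dom A.pt.smooth A.pt.jacobian_ne_zero hmaps
    refine ⟨δ₀, δ₁, δ₂, δ₃, hδ, fun p hpd => ?_⟩
    obtain ⟨q1, q2, q3, q4, q5⟩ := hp p hpd
    refine ⟨q1, ?_, q4, q5⟩
    have := hel p hpd
    rw [q2, q3] at this
    exact this
  -- One equation fixes the parameters. Another pair (h, l) gives the same δ₁ and δ₃, since these
  -- are X_x and U_u of the same map.
  obtain ⟨δ₀, δ₁, δ₂, δ₃, hδ, hp⟩ := key 1 0 one_ne_zero
  refine ⟨δ₀, δ₁, δ₂, δ₃, hδ, fun t x u hd => ⟨(hp _ hd).1, fun h l hh => ?_⟩⟩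
  obtain ⟨_, δ₁', _, δ₃', -, hp'⟩ := key h l hh
  obtain ⟨-, r2, r3, r4⟩ := hp' _ hd
  rw [r2, ← r3, ← r4, (hp _ hd).2.2.1, (hp _ hd).2.2.2]

/-- The everywhere defined element of the equivalence group with given parameters. -/
noncomputable def scalingJoint (δ₀ δ₂ : ℝ) {δ₁ δ₃ : ℝ} (hδ : δ₁ * δ₃ ≠ 0) :
    JointTransformation where
  pt :=
    { dom := univ
      isOpen_dom := isOpen_univ
      isConnected_dom := isConnected_univ
      toFun := scaling δ₀ δ₁ δ₂ δ₃
      smooth := contDiff_scaling.contDiffOn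
      jacobian_ne_zero := fun p _ => det_ne_zero_of_injective fun d hd => by
        have h1 := left_ne_zero_of_mul hδ
        have h3 := right_ne_zero_of_mul hδ
        rw [fderiv_scaling] at hd
        simpa [Prod.ext_iff, h1, h3] using hd }
  elems := fun q => (δ₁ ^ 2 * q.2.1, δ₃ ^ 2 / δ₁ * q.2.2)
  smooth := ContDiff.contDiffOn (by fun_prop)
  jacobian_ne_zero := fun q _ _ => det_ne_zero_of_injective fun d hd => by
    have h1 := left_ne_zero_of_mul hδ
    have h3 := right_ne_zero_of_mul hδ
    have hs : HasFDerivAt (scaling δ₀ δ₁ δ₂ δ₃) (fderiv ℝ (scaling δ₀ δ₁ δ₂ δ₃) q.1) q.1 :=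
      (contDiff_scaling.differentiable (by simp) _).hasFDerivAt
    have hf : HasFDerivAt (fun q : Space × (ℝ × ℝ) =>
        (scaling δ₀ δ₁ δ₂ δ₃ q.1, ((δ₁ ^ 2 * q.2.1, δ₃ ^ 2 / δ₁ * q.2.2) : ℝ × ℝ)))
        (((fderiv ℝ (scaling δ₀ δ₁ δ₂ δ₃) q.1).comp
          (ContinuousLinearMap.fst ℝ Space (ℝ × ℝ))).prod
          (((δ₁ ^ 2) • (ContinuousLinearMap.fst ℝ ℝ ℝ).comp
            (ContinuousLinearMap.snd ℝ Space (ℝ × ℝ))).prod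
          ((δ₃ ^ 2 / δ₁) • (ContinuousLinearMap.snd ℝ ℝ ℝ).comp
            (ContinuousLinearMap.snd ℝ Space (ℝ × ℝ))))) q :=
      (hs.comp q hasFDerivAt_fst).prodMk
        ((hasFDerivAt_snd.fst.const_mul _).prodMk (hasFDerivAt_snd.snd.const_mul _))
    rw [hf.fderiv] at hd
    simp only [ContinuousLinearMap.prod_apply, ContinuousLinearMap.comp_apply,
      fderiv_scaling] at hd
    simpa [Prod.ext_iff, h1, h3] using hd

theorem normalizedUsual : NormalizedUsual := fun a => by
  obtain ⟨δ₀, δ₁, δ₂, δ₃, hδ, hp⟩ := exists_parameters a.map.isOpen_dom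
    a.map.isConnected_dom a.map.smooth a.map.jacobian_ne_zero a.maps
  refine ⟨scalingJoint δ₀ δ₂ hδ, ?_, rfl, fun p hpd => (hp p hpd).1, fun p hpd => ?_⟩
  · exact JointTransformation.isUsualEquivalence_of_scaling (δ₀ := δ₀) (δ₂ := δ₂) _ hδ
      fun t x u _ => ⟨rfl, fun h l _ => rfl⟩
  · obtain ⟨q1, q2, q3, -⟩ := hp p hpd
    have e : (scalingJoint δ₀ δ₂ hδ).pt.toFun p = a.map.toFun p := q1.symm
    rw [e, q2, q3]
    rfl

end Scaling

end BBM

theorem theorem4 :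
    (∀ A : BBM.JointTransformation,
      A.IsUsualEquivalence ↔
        ∃ δ₀ δ₁ δ₂ δ₃ : ℝ, δ₁ * δ₃ ≠ 0 ∧
          ∀ t x u : ℝ, (t, x, u) ∈ A.pt.dom →
            A.pt.toFun (t, x, u) = (δ₁ / δ₃ * t + δ₀, δ₁ * x + δ₂, δ₃ * u) ∧
            ∀ h l : ℝ, h ≠ 0 →
              A.elems ((t, x, u), (h, l)) = (δ₁ ^ 2 * h, δ₃ ^ 2 / δ₁ * l)) ∧
    BBM.NormalizedUsual :=
  ⟨fun A => ⟨fun hA => hA.exists_parameters, fun ⟨_, _, _, _, hδ, hA⟩ =>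
    A.isUsualEquivalence_of_scaling hδ hA⟩, BBM.normalizedUsual⟩
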